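/- Let $L,M>0$ and let $\Gamma$ be the graph of a continuous, convex, strictly decreasing function $f:[0,L]\to[0,M]$ with $f(0)=M$ and $f(L)=0$; let $g:[0,M]\to[0,L]$ be the inverse function of $f$, and let $\operatorname{Area}(\Gamma)$ be the area enclosed by $\Gamma$ and the coordinate axes. For $r,s>0$ let \[ N(r,s)=\#\{(j,k): j,k\ge 1 \text{ integers},\ js/r\le L,\ k\le rs\,f(js/r)\}, \] the number of positive-integer lattice points inside or on the curve obtained from $\Gamma$ by $(x,y)\mapsto (rs^{-1}x,\,rsy)$, and let $S(r)$ be the set of all $s>0$ that maximize $N(r,s)$ over $s>0$. Let $(\alpha,\beta)\in\Gamma$ with $0<\alpha<L/2$ and $0<\beta<M/2$. Assume that $f\in C^2[\alpha,L)$ with $f'<0$ and $f''>0$ on $[\alpha,L)$, and $g\in C^2[\beta,M)$ with $g'<0$ and $g''>0$ on $[\beta,M)$ (derivatives at the left endpoints being one-sided). Assume there are partitions $\alpha=\alpha_0<\alpha_1<\dots<\alpha_m=L$ and $\beta=\beta_0<\beta_1<\dots<\beta_n=M$ such that $f''$ is monotonic on each $(\alpha_i,\alpha_{i+1})$ and $g''$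 is monotonic on each $(\beta_i,\beta_{i+1})$. Assume further that there are functions $\delta:(0,\infty)\to(0,L/2-\alpha)$ and $\epsilon:(0,\infty)\to(0,M/2-\beta)$ and constants $a_1,a_2,b_1,b_2>0$ such that, as $r\to\infty$, \[ \delta(r)=O(r^{-2a_1}),\quad \frac1{f''(L-\delta(r))}=O(r^{1-4a_2}),\quad \epsilon(r)=O(r^{-2b_1}),\quad \frac1{g''(M-\epsilon(r))}=O(r^{1-4b_2}). \] Finally assume $L=M$, and put $e=\min\left(\tfrac16,a_1,a_2,b_1,b_2\right)$. Then for every $r>0$ the maximum of $N(r,s)$ over $s>0$ is attained, so that $S(r)\ne\emptyset$; the optimal stretch factors approach $1$ as $r\to\infty$ (uniformly over $s\in S(r)$); more precisely, there is a constant $C$ such that \[ S(r)\subset\left[1-Cr^{-e},\,1+Cr^{-e}\right]\qquad\text{for all sufficiently large } r; \] and \[ \max_{s>0}N(r,s)=r^2\operatorname{Area}(\Gamma)-rL+O(r^{1-2e})\qquad\text{as } r\to\infty . \] -/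

import Mathlib

open Set Filter Asymptotics MeasureTheory

/-- `f` represents a convex, strictly decreasing (continuous) curve in the first quadrant, with
intercepts `x = L` and `y = M` on the axes. Only the values of `f` on `[0, L]` matter. -/
structure IsConvexDecreasingCurve (f : ℝ → ℝ) (L M : ℝ) : Prop where
  L_pos : 0 < L
  M_pos : 0 < M
  convex : ConvexOn ℝ (Icc 0 L) f
  strictAnti : StrictAntiOn f (Icc 0 L)
  continuous : ContinuousOn f (Icc 0 L)
  map_zero : f 0 = M
  map_L : f L = 0

/-- The inverse `g` of `f : [0, L] → [0, M]`; arbitrary outside `[0, M]`. -/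
noncomputable def curveInverse (f : ℝ → ℝ) (L : ℝ) : ℝ → ℝ :=
  Function.invFunOn f (Icc 0 L)

/-- The area enclosed by the graph of `f` over `[0, L]` and the two axes: the area of
`{(x, y) | 0 < x < L, 0 < y < f x}`. -/
noncomputable def curveArea (f : ℝ → ℝ) (L : ℝ) : ℝ :=
  (volume : Measure (ℝ × ℝ)).real (regionBetween (fun _ => 0) f (Ioo 0 L))

/-- There is a partition `a = p 0 < p 1 < ⋯ < p m = b` such that `h` is monotonic
(increasing or decreasing, not necessarily strictly) on each open interval `(p i, p (i + 1))`. -/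
def PiecewiseMonotonic (h : ℝ → ℝ) (a b : ℝ) : Prop :=
  ∃ (m : ℕ) (p : Fin (m + 1) → ℝ), StrictMono p ∧ p 0 = a ∧ p (Fin.last m) = b ∧
    ∀ i : Fin m, MonotoneOn h (Ioo (p i.castSucc) (p i.succ)) ∨
      AntitoneOn h (Ioo (p i.castSucc) (p i.succ))

/-- The second derivative of `h` on `[a, b)`, one-sided at `a`. -/
noncomputable def secondDeriv (h : ℝ → ℝ) (a b : ℝ) : ℝ → ℝ :=
  iteratedDerivWithin 2 h (Ico a b)

/-- `h ∈ C²[a, b)` with `h' < 0` and `h'' > 0` on `[a, b)` and `h''` piecewise monotonic. The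
derivatives at `a` are one-sided. -/
structure IsRegularOn (h : ℝ → ℝ) (a b : ℝ) : Prop where
  contDiffOn : ContDiffOn ℝ 2 h (Ico a b)
  deriv_neg : ∀ x ∈ Ico a b, derivWithin h (Ico a b) x < 0
  secondDeriv_pos : ∀ x ∈ Ico a b, 0 < secondDeriv h a b x
  piecewise : PiecewiseMonotonic (secondDeriv h a b) a b

/-- The number `N(r, s)` of positive-integer lattice points `(j, k)` lying inside or on the curve
that is the graph of `x ↦ r s f (s x / r)`, `0 ≤ x ≤ r L / s`. -/
noncomputable def latticeCount (f : ℝ → ℝ) (L r s : ℝ) : ℕ :=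
  {p : ℕ × ℕ | 0 < p.1 ∧ 0 < p.2 ∧ (p.1 : ℝ) * s / r ≤ L ∧
    (p.2 : ℝ) ≤ r * s * f ((p.1 : ℝ) * s / r)}.ncard

/-- The set `S(r)` of all `s > 0` that maximize `N(r, s)` over `s > 0`. -/
def optimalStretch (f : ℝ → ℝ) (L r : ℝ) : Set ℝ :=
  {s | 0 < s ∧ ∀ t, 0 < t → latticeCount f L r t ≤ latticeCount f L r s}

/-- `max_{s > 0} N(r, s)`, as the supremum of a set of natural numbers. -/
noncomputable def maxLatticeCount (f : ℝ → ℝ) (L r : ℝ) : ℕ :=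
  sSup (latticeCount f L r '' Ioi 0)

/-! Uniformly for `s` in a compact subset of `(0, ∞)`, the count satisfies `N(r, s) = r² Area - r (L
/ s + M s) / 2 + O(r ^ (1 - 2e))` (`exists_abs_latticeCount_sub_le`). When `L = M`, a maximizer `s`
does at least as well as `1`, and `L / s + L s - 2L = L (s - 1)² / s`; hence `(s - 1)² = O(r ^
(-2e))`. The value at `1` and the inequality `L / s + L s ≥ 2L` give the maximum.

Compactness of the set of maximizers comes first. By convexity every column of cells in the left
half wastes a triangle, so `N(r, s) ≤ r² Area - c r s` as long as `s ≤ r L` (`latticeCount_le`), and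
comparison with `N(r, 1)` bounds `s` above. Passing to the inverse curve replaces `s` by `s⁻¹` and
bounds `s` below.

For the asymptotic formula the points are split at `(α, f α)` into columns to the right, rows above,
and a full rectangle (`latticeCount_split`). Euler–Maclaurin summation for convex functions turns
each floor sum into an integral, boundary terms and a sum of the sawtooth `saw` along the scaled
curve (`abs_sum_floor_sub_le`). Everything then rests on bounding the sawtooth sums.

The sawtooth is squeezed between difference quotients of the periodic Bernoulli function, whose
cosine series converges absolutely. Each mode is an exponential sum, bounded by van der Corput's
second derivative test in a discrete form that sees only second differences. For `N` terms with
second differences of order `μ` this yields `N μ^(1/3) + μ^(-1/2)`. Monotonic second differences are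
handled by cutting into blocks on which they vary by at most a factor `4` (`abs_sum_saw_le`). Along
the curve the first term contributes `r^(2/3)`; the second is governed by the smallest value of the
second derivative away from the intercept; the points closer to the intercept are counted trivially.
-/

/-! ### Exponential sums: Kuzmin–Landau and van der Corput. -/

/-- The additive character `x ↦ exp (2 π i x)`. -/
noncomputable def ePhase (x : ℝ) : ℂ := Complex.exp ((2 * Real.pi * x : ℝ) * Complex.I)

lemma norm_ePhase (x : ℝ) : ‖ePhase x‖ = 1 := Complex.norm_exp_ofReal_mul_I _

lemma ePhase_add (x y : ℝ) : ePhase (x + y) = ePhase x * ePhase y := by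
  unfold ePhase
  rw [← Complex.exp_add]
  congr 1
  push_cast
  ring

lemma ePhase_re (x : ℝ) : (ePhase x).re = Real.cos (2 * Real.pi * x) := by
  rw [ePhase, Complex.exp_ofReal_mul_I_re]

lemma ePhase_int (m : ℤ) : ePhase m = 1 := by
  unfold ePhase
  rw [Complex.exp_eq_one_iff]
  exact ⟨m, by push_cast; ring⟩

/-- The cotangent of `π d`. -/
noncomputable def cotPi (d : ℝ) : ℝ := Real.cos (Real.pi * d) / Real.sin (Real.pi * d)

/-- The value `1 / (exp (2 π i d) - 1)` in terms of the cotangent. -/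
noncomputable def abelCoeff (d : ℝ) : ℂ := -1 / 2 - (cotPi d / 2 : ℝ) * Complex.I

lemma abelCoeff_mul {d : ℝ} (h : Real.sin (Real.pi * d) ≠ 0) :
    abelCoeff d * (ePhase d - 1) = 1 := by
  have h1 : ePhase d = (Real.cos (2 * (Real.pi * d)) : ℂ) +
      (Real.sin (2 * (Real.pi * d)) : ℂ) * Complex.I := by
    rw [ePhase, Complex.exp_mul_I, ← Complex.ofReal_cos, ← Complex.ofReal_sin, mul_assoc]
  rw [h1, abelCoeff, cotPi, Real.cos_two_mul', Real.sin_two_mul]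
  have hs : (Real.sin (Real.pi * d))^2 + Real.cos (Real.pi * d) ^ 2 = 1 :=
    Real.sin_sq_add_cos_sq _
  set S := Real.sin (Real.pi * d)
  set C := Real.cos (Real.pi * d)
  rw [sq, sq]
  rw [sq, sq] at hs
  apply Complex.ext
  · simp
    field_simp
    linear_combination hs
  · simp
    field_simp
    linear_combination (-C) * hs

lemma two_mul_le_sin_pi {θ d : ℝ} (h0 : θ ≤ d) (h1 : d ≤ 1 - θ) (hθ : 0 ≤ θ) :
    2 * θ ≤ Real.sin (Real.pi * d) := by
  have hp := Real.pi_pos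
  rcases le_total d (1 / 2) with h | h
  · have := Real.mul_le_sin (x := Real.pi * d) (by nlinarith) (by nlinarith)
    have e : 2 / Real.pi * (Real.pi * d) = 2 * d := by field_simp
    linarith
  · have := Real.mul_le_sin (x := Real.pi * (1 - d)) (by nlinarith) (by nlinarith)
    have e : 2 / Real.pi * (Real.pi * (1 - d)) = 2 * (1 - d) := by field_simp
    have e2 : Real.sin (Real.pi * (1 - d)) = Real.sin (Real.pi * d) := by
      rw [mul_sub, mul_one, Real.sin_pi_sub]
    linarith

lemma abs_cotPi_le {θ d : ℝ} (h0 : θ ≤ d) (h1 : d ≤ 1 - θ) (hθ : 0 < θ) :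
    |cotPi d| ≤ 1 / (2 * θ) := by
  have h := two_mul_le_sin_pi h0 h1 hθ.le
  rw [cotPi, abs_div, abs_of_pos (by linarith : 0 < Real.sin (Real.pi * d))]
  exact div_le_div₀ zero_le_one (Real.abs_cos_le_one _) (by linarith) h

lemma cotPi_antitone {a b : ℝ} (ha : 0 < a) (hab : a ≤ b) (hb : b < 1) : cotPi b ≤ cotPi a := by
  have hp := Real.pi_pos
  have sa : 0 < Real.sin (Real.pi * a) := Real.sin_pos_of_pos_of_lt_pi (by positivity) (by nlinarith)
  have sb : 0 < Real.sin (Real.pi * b) :=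
    Real.sin_pos_of_pos_of_lt_pi (by nlinarith) (by nlinarith)
  have h : 0 ≤ Real.sin (Real.pi * b - Real.pi * a) :=
    Real.sin_nonneg_of_nonneg_of_le_pi (by nlinarith) (by nlinarith)
  rw [Real.sin_sub] at h
  unfold cotPi
  rw [div_le_div_iff₀ sb sa]
  linarith

lemma norm_abelCoeff_le {θ d : ℝ} (h0 : θ ≤ d) (h1 : d ≤ 1 - θ) (hθ : 0 < θ) :
    ‖abelCoeff d‖ ≤ 1 / (2 * θ) := by
  have h := abs_cotPi_le h0 h1 hθ
  have hq : 1 ≤ 1 / (2 * θ) := by rw [le_div_iff₀ (by positivity)]; linarith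
  have h2 : ‖(-1 / 2 : ℂ)‖ = 1 / 2 := by norm_num
  have h3 : ‖((cotPi d / 2 : ℝ) : ℂ) * Complex.I‖ = |cotPi d| / 2 := by
    rw [norm_mul, Complex.norm_I, mul_one, Complex.norm_real, Real.norm_eq_abs, abs_div]
    norm_num
  calc ‖abelCoeff d‖ ≤ ‖(-1 / 2 : ℂ)‖ + ‖((cotPi d / 2 : ℝ) : ℂ) * Complex.I‖ := norm_sub_le _ _
    _ ≤ 1 / (2 * θ) := by rw [h2, h3]; linarith

/-- The Kuzmin–Landau inequality. -/
lemma norm_sum_ePhase_le_of_differences (x : ℕ → ℝ) (N : ℕ) {θ : ℝ} (hθ : 0 < θ)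
    (hd : ∀ n < N, θ ≤ x (n + 1) - x n ∧ x (n + 1) - x n ≤ 1 - θ)
    (hm : ∀ n, n + 1 < N → x (n + 1) - x n ≤ x (n + 2) - x (n + 1)) :
    ‖∑ n ∈ Finset.range N, ePhase (x n)‖ ≤ 2 / θ := by
  rcases N with _ | K
  · simp; positivity
  have hstep : ∀ n < K + 1, ePhase (x n) =
      abelCoeff (x (n + 1) - x n) * (ePhase (x (n + 1)) - ePhase (x n)) := by
    intro n hn
    have h := hd n hn
    have hs := two_mul_le_sin_pi h.1 h.2 hθ.le
    have e : ePhase (x (n + 1)) = ePhase (x n) * ePhase (x (n + 1) - x n) := by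
      rw [← ePhase_add]; ring_nf
    rw [e]
    have := abelCoeff_mul (d := x (n + 1) - x n) (by linarith)
    linear_combination (-ePhase (x n)) * this
  -- Summation by parts with the boundary terms moved to the left. The coefficients differ only in
  -- their imaginary parts, which are cotangents of increasing arguments, so their total variation
  -- telescopes.
  have key : ∀ k ≤ K, ‖∑ n ∈ Finset.range (k + 1), ePhase (x n)
      - abelCoeff (x (k + 1) - x k) * ePhase (x (k + 1))
      + abelCoeff (x 1 - x 0) * ePhase (x 0)‖ ≤
        (cotPi (x 1 - x 0) - cotPi (x (k + 1) - x k)) / 2 := by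
    intro k
    induction k with
    | zero =>
      intro _
      have := hstep 0 (by omega)
      have e : ∑ n ∈ Finset.range (0 + 1), ePhase (x n)
        - abelCoeff (x (0 + 1) - x 0) * ePhase (x (0 + 1))
        + abelCoeff (x 1 - x 0) * ePhase (x 0) = 0 := by
        simp only [zero_add, Finset.sum_range_one] at this ⊢
        linear_combination this
      rw [e]; simp
    | succ k ih =>
      intro hk
      have ih := ih (by omega)
      have hs := hstep (k + 1) (by omega)
      have hm' := hm k (by omega)
      have h0 := hd k (by omega)
      have h1 := hd (k + 1) (by omega)
      have hc := cotPi_antitone (by linarith) hm' (by linarith [h1.2])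
      have e : ∑ n ∈ Finset.range (k + 1 + 1), ePhase (x n)
          - abelCoeff (x (k + 1 + 1) - x (k + 1)) * ePhase (x (k + 1 + 1))
          + abelCoeff (x 1 - x 0) * ePhase (x 0) =
          (∑ n ∈ Finset.range (k + 1), ePhase (x n)
          - abelCoeff (x (k + 1) - x k) * ePhase (x (k + 1))
          + abelCoeff (x 1 - x 0) * ePhase (x 0)) +
          (abelCoeff (x (k + 1) - x k) - abelCoeff (x (k + 1 + 1) - x (k + 1))) *
            ePhase (x (k + 1)) := by
        rw [Finset.sum_range_succ]
        linear_combination hs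
      have e2 : ‖abelCoeff (x (k + 1) - x k) - abelCoeff (x (k + 1 + 1) - x (k + 1))‖ =
          (cotPi (x (k + 1) - x k) - cotPi (x (k + 1 + 1) - x (k + 1))) / 2 := by
        have : abelCoeff (x (k + 1) - x k) - abelCoeff (x (k + 1 + 1) - x (k + 1)) =
          (((cotPi (x (k + 1 + 1) - x (k + 1)) - cotPi (x (k + 1) - x k)) / 2 : ℝ) : ℂ)
            * Complex.I := by
          unfold abelCoeff; push_cast; ring
        rw [this, norm_mul, Complex.norm_I, mul_one, Complex.norm_real, Real.norm_eq_abs,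
          abs_of_nonpos (by linarith)]
        ring
      rw [e]
      refine (norm_add_le _ _).trans ?_
      rw [norm_mul, norm_ePhase, mul_one, e2]
      linarith
  have hK := key K le_rfl
  have a0 := hd 0 (by omega)
  have a1 := hd K (by omega)
  simp only [zero_add] at a0
  have b0 := norm_abelCoeff_le a0.1 a0.2 hθ
  have b1 := norm_abelCoeff_le a1.1 a1.2 hθ
  have c0 := abs_le.1 (abs_cotPi_le a0.1 a0.2 hθ)
  have c1 := abs_le.1 (abs_cotPi_le a1.1 a1.2 hθ)
  have e : ∑ n ∈ Finset.range (K + 1), ePhase (x n) =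
    (∑ n ∈ Finset.range (K + 1), ePhase (x n)
      - abelCoeff (x (K + 1) - x K) * ePhase (x (K + 1))
      + abelCoeff (x 1 - x 0) * ePhase (x 0)) +
      (abelCoeff (x (K + 1) - x K) * ePhase (x (K + 1))
      - abelCoeff (x 1 - x 0) * ePhase (x 0)) := by ring
  rw [e]
  refine (norm_add_le _ _).trans ?_
  have f : ‖abelCoeff (x (K + 1) - x K) * ePhase (x (K + 1))
      - abelCoeff (x 1 - x 0) * ePhase (x 0)‖ ≤ 1 / (2 * θ) + 1 / (2 * θ) := by
    refine (norm_sub_le _ _).trans ?_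
    rw [norm_mul, norm_mul, norm_ePhase, norm_ePhase, mul_one, mul_one]
    linarith
  have g : 2 / θ = 4 * (1 / (2 * θ)) := by field_simp; norm_num
  have : 0 < 1 / (2 * θ) := by positivity
  linarith

/-- A monotone sequence crosses a level only once; this is how index ranges are cut below. -/
lemma exists_threshold (d : ℕ → ℝ) (N : ℕ) (v : ℝ) (hd : ∀ n, n + 1 < N → d n ≤ d (n + 1)) :
    ∃ i ≤ N, (∀ n < i, d n < v) ∧ ∀ n, i ≤ n → n < N → v ≤ d n := by
  induction N with
  | zero => exact ⟨0, le_rfl, by simp, by simp⟩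
  | succ N ih =>
    obtain ⟨i, hi, h1, h2⟩ := ih (fun n hn => hd n (by omega))
    by_cases h : v ≤ d N
    · refine ⟨i, by omega, h1, fun n hn hn' => ?_⟩
      rcases Nat.lt_succ_iff_lt_or_eq.1 hn' with h' | rfl
      · exact h2 n hn h'
      · exact h
    · have hiN : i = N := by
        by_contra hne
        have := h2 (N - 1) (by omega) (by omega)
        have h3 := hd (N - 1) (by omega)
        rw [Nat.sub_add_cancel (by omega)] at h3
        exact h (this.trans h3)
      refine ⟨N + 1, le_rfl, fun n hn => ?_, fun n hn hn' => by omega⟩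
      rcases Nat.lt_succ_iff_lt_or_eq.1 hn with h' | rfl
      · exact h1 n (hiN ▸ h')
      · exact not_le.1 h

/-- The second difference of a sequence. -/
def secondDiff (x : ℕ → ℝ) (n : ℕ) : ℝ := x (n + 2) - 2 * x (n + 1) + x n

lemma mul_le_diff_of_le_secondDiff (x : ℕ → ℝ) (N : ℕ) {μ : ℝ}
    (hD : ∀ n < N, μ ≤ secondDiff x n) :
    N * μ ≤ (x (N + 1) - x N) - (x 1 - x 0) := by
  induction N with
  | zero => simp
  | succ N ih =>
    have := ih (fun n hn => hD n (by omega))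
    have h := hD N (by omega)
    unfold secondDiff at h
    push_cast
    rw [show N + 1 + 1 = N + 2 from rfl]
    linarith

lemma diff_le_mul_of_secondDiff_le (x : ℕ → ℝ) (N : ℕ) {μ : ℝ}
    (hD : ∀ n < N, secondDiff x n ≤ μ) :
    (x (N + 1) - x N) - (x 1 - x 0) ≤ N * μ := by
  induction N with
  | zero => simp
  | succ N ih =>
    have := ih (fun n hn => hD n (by omega))
    have h := hD N (by omega)
    unfold secondDiff at h
    push_cast
    rw [show N + 1 + 1 = N + 2 from rfl]
    linarith

lemma norm_sum_ePhase_le_card (x : ℕ → ℝ) (N : ℕ) :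
    ‖∑ n ∈ Finset.range N, ePhase (x n)‖ ≤ N := by
  refine (norm_sum_le _ _).trans ?_
  simp [norm_ePhase]

/-- The first differences grow by at least `μ` per step, so at most `θ / μ + 1` of them fit in a
window of width `θ`, and the trivial bound is enough. -/
lemma norm_sum_ePhase_le_of_short (x : ℕ → ℝ) (N : ℕ) {μ θ v : ℝ} (hμ : 0 < μ) (hθ : 0 ≤ θ)
    (hD : ∀ n < N, μ ≤ secondDiff x n)
    (hd : ∀ n < N, v ≤ x (n + 1) - x n ∧ x (n + 1) - x n ≤ v + θ) :
    ‖∑ n ∈ Finset.range N, ePhase (x n)‖ ≤ θ / μ + 1 := by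
  refine (norm_sum_ePhase_le_card x N).trans ?_
  rcases N with _ | K
  · simp; positivity
  have h := mul_le_diff_of_le_secondDiff x K (fun n hn => hD n (by omega))
  have h0 := hd 0 (by omega)
  have h1 := hd K (by omega)
  simp only [zero_add] at h0
  have : (K : ℝ) ≤ θ / μ := by
    rw [le_div_iff₀ hμ]; linarith
  push_cast; linarith

/-- Kuzmin–Landau applies where the first differences keep distance `θ` from the integers `m` and `m
+ 1`; the two remaining ends are short. -/
lemma norm_sum_ePhase_le_of_floor (x : ℕ → ℝ) (N : ℕ) (m : ℤ) {μ θ : ℝ} (hμ : 0 < μ)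
    (hθ : 0 < θ) (hD : ∀ n < N, μ ≤ secondDiff x n)
    (hd : ∀ n < N, (m : ℝ) ≤ x (n + 1) - x n ∧ x (n + 1) - x n < m + 1) :
    ‖∑ n ∈ Finset.range N, ePhase (x n)‖ ≤ 2 * (θ / μ + 1) + 2 / θ := by
  have hmono : ∀ n < N, x (n + 1) - x n ≤ x (n + 2) - x (n + 1) := by
    intro n hn
    have := hD n hn
    unfold secondDiff at this
    linarith
  obtain ⟨i, hi, hi1, hi2⟩ := exists_threshold (fun n => x (n + 1) - x n) N (m + θ)
    (fun n hn => hmono n (by omega))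
  obtain ⟨p, rfl⟩ := Nat.exists_eq_add_of_le hi
  obtain ⟨j, hj, hj1, hj2⟩ := exists_threshold (fun n => x (i + n + 1) - x (i + n)) p (m + 1 - θ)
    (fun n hn => hmono (i + n) (by omega))
  obtain ⟨q, rfl⟩ := Nat.exists_eq_add_of_le hj
  rw [Finset.sum_range_add, Finset.sum_range_add]
  have A : ‖∑ n ∈ Finset.range i, ePhase (x n)‖ ≤ θ / μ + 1 :=
    norm_sum_ePhase_le_of_short x i hμ hθ.le (fun n hn => hD n (by omega))
      (v := m) (fun n hn => ⟨(hd n (by omega)).1, (hi1 n hn).le⟩)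
  have C : ‖∑ n ∈ Finset.range q, ePhase (x (i + (j + n)))‖ ≤ θ / μ + 1 := by
    refine norm_sum_ePhase_le_of_short (fun n => x (i + (j + n))) q hμ hθ.le
      (fun n hn => hD (i + (j + n)) (by omega)) (v := m + 1 - θ) (fun n hn => ⟨?_, ?_⟩)
    · exact hj2 (j + n) (by omega) (by omega)
    · have := (hd (i + (j + n)) (by omega)).2.le
      rw [sub_add_cancel]
      exact this
  have B : ‖∑ n ∈ Finset.range j, ePhase (x (i + n))‖ ≤ 2 / θ := by
    -- Subtracting the integer `m * n` leaves the character unchanged and moves the first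
    -- differences into `[θ, 1 - θ]`.
    have e : ∀ n, ePhase (x (i + n)) = ePhase (x (i + n) - m * n) := by
      intro n
      have : x (i + n) = (x (i + n) - m * n) + ((m * n : ℤ) : ℝ) := by push_cast; ring
      conv_lhs => rw [this, ePhase_add, ePhase_int, mul_one]
    simp_rw [e]
    refine norm_sum_ePhase_le_of_differences (fun n => x (i + n) - m * n) j hθ
      (fun n hn => ⟨?_, ?_⟩) (fun n hn => ?_)
    · have := hi2 (i + n) (by omega) (by omega)
      push_cast
      rw [← add_assoc]
      linarith
    · have := hj1 n hn
      push_cast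
      rw [← add_assoc]
      linarith
    · have := hmono (i + n) (by omega)
      push_cast
      rw [← add_assoc, ← add_assoc]
      linarith
  refine (norm_add_le _ _).trans ((add_le_add le_rfl (norm_add_le _ _)).trans ?_)
  linarith

/-- One block for each integer part that the first differences can take; the induction removes the
block with the largest integer part. -/
lemma norm_sum_ePhase_le_floor_diff (x : ℕ → ℝ) {μ θ : ℝ} (hμ : 0 < μ) (hθ : 0 < θ) (N : ℕ)
    (hD : ∀ n < N + 1, μ ≤ secondDiff x n) :
    ‖∑ n ∈ Finset.range (N + 1), ePhase (x n)‖ ≤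
      (2 * (θ / μ + 1) + 2 / θ) * (⌊x (N + 1) - x N⌋ - ⌊x 1 - x 0⌋ + 1) := by
  induction N using Nat.strong_induction_on with
  | _ N ih =>
  have hmono : ∀ n < N + 1, x (n + 1) - x n ≤ x (n + 2) - x (n + 1) := by
    intro n hn
    have := hD n hn
    unfold secondDiff at this
    linarith
  have hmono' : ∀ k ≤ N, ∀ n ≤ k, x (n + 1) - x n ≤ x (k + 1) - x k := by
    intro k hk
    induction k with
    | zero => intro n hn; rw [Nat.le_zero.1 hn]
    | succ k ih' =>
      intro n hn
      rcases Nat.le_succ_iff.1 hn with h | rfl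
      · exact (ih' (by omega) n h).trans (hmono k (by omega))
      · rfl
  set m := ⌊x (N + 1) - x N⌋ with hm
  obtain ⟨i, hi, hi1, hi2⟩ := exists_threshold (fun n => x (n + 1) - x n) (N + 1) m
    (fun n hn => hmono n (by omega))
  have hiN : i ≤ N := by
    by_contra h
    have := hi1 N (by omega)
    exact absurd (Int.floor_le (x (N + 1) - x N)) (not_le.2 this)
  obtain ⟨p, hp⟩ := Nat.exists_eq_add_of_le hi
  set B := 2 * (θ / μ + 1) + 2 / θ with hB
  have hB0 : 0 ≤ B := by positivity
  rw [hp, Finset.sum_range_add]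
  have A : ‖∑ n ∈ Finset.range p, ePhase (x (i + n))‖ ≤ B := by
    refine norm_sum_ePhase_le_of_floor (fun n => x (i + n)) p m hμ hθ
      (fun n hn => hD (i + n) (by omega)) (fun n hn => ⟨hi2 (i + n) (by omega) (by omega), ?_⟩)
    exact (hmono' N le_rfl (i + n) (by omega)).trans_lt (Int.lt_floor_add_one _)
  refine (norm_add_le _ _).trans ?_
  rcases i with _ | i
  · have h0 : (⌊x 1 - x 0⌋ : ℝ) ≤ m := by
      exact_mod_cast Int.floor_le_floor (hmono' N le_rfl 0 (by omega))
    simp only [Finset.range_zero, Finset.sum_empty, norm_zero, zero_add] at A ⊢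
    nlinarith
  · have h := ih i (by omega) (fun n hn => hD n (by omega))
    have h1 : (⌊x (i + 1) - x i⌋ : ℝ) + 1 ≤ m := by
      exact_mod_cast Int.floor_lt.2 (hi1 i (by omega))
    have : B * (⌊x (i + 1) - x i⌋ - ⌊x 1 - x 0⌋ + 1) ≤ B * (m - ⌊x 1 - x 0⌋) :=
      mul_le_mul_of_nonneg_left (by linarith) hB0
    linarith

/-- The second derivative test of van der Corput, for sequences. -/
lemma norm_sum_ePhase_le_of_secondDiff (x : ℕ → ℝ) (N : ℕ) {μ : ℝ} (hμ : 0 < μ)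
    (hD : ∀ n < N, μ ≤ secondDiff x n ∧ secondDiff x n ≤ 4 * μ) :
    ‖∑ n ∈ Finset.range N, ePhase (x n)‖ ≤ 20 * N * √μ + 10 / √μ := by
  have hs : 0 < √μ := Real.sqrt_pos.2 hμ
  have hsq : √μ * √μ = μ := Real.mul_self_sqrt hμ.le
  -- For `√μ ≥ 1/2` the trivial bound `N` suffices; otherwise `1 / √μ ≥ 2` absorbs the additive
  -- constants.
  rcases le_total (1 / 2) √μ with h | h
  · refine (norm_sum_ePhase_le_card x N).trans ?_
    have : 0 ≤ 10 / √μ := by positivity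
    have : (0 : ℝ) ≤ N := Nat.cast_nonneg N
    nlinarith
  rcases N with _ | K
  · simp only [Finset.range_zero, Finset.sum_empty, norm_zero]; positivity
  -- The choice `θ = √μ` balances `θ / μ` against `1 / θ`.
  have h1 := norm_sum_ePhase_le_floor_diff x hμ hs K (fun n hn => (hD n hn).1)
  have h2 := diff_le_mul_of_secondDiff_le x K (fun n hn => (hD n (by omega)).2)
  have h3 := Int.floor_le (x (K + 1) - x K)
  have h4 := Int.lt_floor_add_one (x 1 - x 0)
  have e1 : √μ / μ = 1 / √μ := by rw [div_eq_div_iff hμ.ne' hs.ne']; linarith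
  have hB : 2 * (√μ / μ + 1) + 2 / √μ ≤ 5 / √μ := by
    rw [e1]
    have : 2 ≤ 1 / √μ := by rw [le_div_iff₀ hs]; linarith
    have e2 : 2 / √μ = 2 * (1 / √μ) := by ring
    have e5 : 5 / √μ = 5 * (1 / √μ) := by ring
    rw [e2, e5]; linarith
  have hF : (⌊x (K + 1) - x K⌋ - ⌊x 1 - x 0⌋ + 1 : ℝ) ≤ 4 * (K + 1) * μ + 2 := by nlinarith
  have e : (5 / √μ) * (4 * (K + 1) * μ + 2) = 20 * ((K + 1 : ℕ) : ℝ) * √μ + 10 / √μ := by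
    push_cast
    field_simp
    rw [Real.sq_sqrt hμ.le]
    ring
  rw [← e]
  refine h1.trans ((mul_le_mul_of_nonneg_left hF (by positivity)).trans ?_)
  exact mul_le_mul_of_nonneg_right hB (by positivity)

/-! ### Sawtooth sums. -/

/-- The sawtooth function. -/
noncomputable def saw (x : ℝ) : ℝ := Int.fract x - 1 / 2

lemma abs_saw_le (x : ℝ) : |saw x| ≤ 1 / 2 := by
  have h0 := Int.fract_nonneg x
  have h1 := (Int.fract_lt_one x).le
  rw [abs_le, saw]
  constructor <;> linarith

/-- The periodic second Bernoulli function. -/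
noncomputable def periodicBernoulli (x : ℝ) : ℝ := Int.fract x ^ 2 - Int.fract x + 1 / 6

lemma fract_cases {x Δ : ℝ} (h0 : 0 < Δ) (h1 : Δ ≤ 1) :
    Int.fract (x + Δ) = Int.fract x + Δ ∨
      (Int.fract (x + Δ) = Int.fract x + Δ - 1 ∧ 1 ≤ Int.fract x + Δ) := by
  have a := Int.fract_nonneg x
  have b := Int.fract_lt_one x
  have e := Int.floor_add_fract x
  rcases lt_or_ge (Int.fract x + Δ) 1 with h | h
  · left
    rw [Int.fract_eq_iff]
    exact ⟨by linarith, h, ⌊x⌋, by linarith⟩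
  · right
    refine ⟨?_, h⟩
    rw [Int.fract_eq_iff]
    exact ⟨by linarith, by linarith, ⌊x⌋ + 1, by push_cast; linarith⟩

/-- Half the Bernoulli increment is the integral of `saw` over `[x, x + Δ]`. Since `saw` has slope
`1` and jumps only downwards, its mean there exceeds `saw x` by at most `Δ / 2`. The companion upper
bound uses the interval `[x - Δ, x]`. -/
lemma le_saw {Δ : ℝ} (h0 : 0 < Δ) (h1 : Δ ≤ 1) (x : ℝ) :
    (periodicBernoulli (x + Δ) - periodicBernoulli x) / (2 * Δ) - Δ / 2 ≤ saw x := by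
  rw [sub_le_iff_le_add, div_le_iff₀ (by positivity)]
  unfold periodicBernoulli saw
  rcases fract_cases (x := x) h0 h1 with h | ⟨h, h'⟩ <;> rw [h] <;> nlinarith

lemma saw_le {Δ : ℝ} (h0 : 0 < Δ) (h1 : Δ ≤ 1) (x : ℝ) :
    saw x ≤ (periodicBernoulli x - periodicBernoulli (x - Δ)) / (2 * Δ) + Δ / 2 := by
  rw [← sub_le_iff_le_add, le_div_iff₀ (by positivity)]
  obtain ⟨y, rfl⟩ : ∃ y, x = y + Δ := ⟨x - Δ, by ring⟩
  rw [add_sub_cancel_right]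
  unfold periodicBernoulli saw
  rcases fract_cases (x := y) h0 h1 with h | ⟨h, h'⟩ <;> rw [h] <;>
    nlinarith [Int.fract_nonneg y, Int.fract_lt_one y]

lemma hasSum_periodicBernoulli (x : ℝ) :
    HasSum (fun n : ℕ => 1 / (n : ℝ) ^ 2 * Real.cos (2 * Real.pi * (n * x)))
      (Real.pi ^ 2 * periodicBernoulli x) := by
  have h := hasSum_one_div_nat_pow_mul_cos (k := 1) one_ne_zero (x := Int.fract x)
    ⟨Int.fract_nonneg x, (Int.fract_lt_one x).le⟩
  have e : Polynomial.eval (Int.fract x)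
      (Polynomial.map (algebraMap ℚ ℝ) (Polynomial.bernoulli (2 * 1))) =
      Int.fract x ^ 2 - Int.fract x + 6⁻¹ := bernoulliFun_two _
  rw [e] at h
  convert h using 1
  · ext n
    have : 2 * Real.pi * (n * x) = 2 * Real.pi * n * Int.fract x
        + ((n * ⌊x⌋ : ℤ) : ℝ) * (2 * Real.pi) := by
      conv_lhs => rw [← Int.floor_add_fract x]
      push_cast; ring
    rw [this, Real.cos_add_int_mul_two_pi]
  · rw [show Nat.factorial (2 * 1) = 2 from rfl, periodicBernoulli]
    push_cast
    ring

/-- Both ranges telescope: `1 / √k ≤ 2 (√k - √(k - 1))` up to `Q`, and `Q / k^(3/2) ≤ 2Q (1 / √(k -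
1) - 1 / √k)` beyond it. The two bounds agree at `n = Q`. The term `k = 0` vanishes because division
by zero gives zero. -/
lemma sum_min_mul_sqrt_le (Q n : ℕ) :
    (n ≤ Q → ∑ k ∈ Finset.range (n + 1), min (Q / (k : ℝ) ^ 2) (1 / (k : ℝ)) * √k ≤ 2 * √n) ∧
    (Q ≤ n → 1 ≤ Q → ∑ k ∈ Finset.range (n + 1), min (Q / (k : ℝ) ^ 2) (1 / (k : ℝ)) * √k ≤
      4 * √Q - 2 * Q / √n) := by
  have hQ2 : 1 ≤ Q → 4 * √(Q : ℝ) - 2 * Q / √Q = 2 * √Q := by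
    intro hQ
    have h : 0 < √(Q : ℝ) := Real.sqrt_pos.2 (by exact_mod_cast hQ)
    have h2 := Real.mul_self_sqrt (Nat.cast_nonneg (α := ℝ) Q)
    rw [sub_eq_iff_eq_add, ← sub_eq_iff_eq_add', eq_div_iff h.ne']
    linarith
  have fact : ∀ m : ℕ, 0 ≤ √(m : ℝ) ∧ 0 < √((m + 1 : ℕ) : ℝ) ∧
      √((m + 1 : ℕ) : ℝ) ^ 2 = m + 1 ∧ √(m : ℝ) ^ 2 = m ∧ √(m : ℝ) ≤ √((m + 1 : ℕ) : ℝ) := by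
    intro m
    refine ⟨Real.sqrt_nonneg _, Real.sqrt_pos.2 (by positivity), ?_,
      Real.sq_sqrt (Nat.cast_nonneg _), Real.sqrt_le_sqrt (by push_cast; linarith)⟩
    rw [Real.sq_sqrt (by positivity)]; push_cast; rfl
  induction n with
  | zero =>
    refine ⟨fun _ => by simp, fun h h' => by omega⟩
  | succ n ih =>
    have hF : n + 1 ≤ Q → ∑ k ∈ Finset.range (n + 1 + 1), min (Q / (k : ℝ) ^ 2) (1 / (k : ℝ)) * √k
        ≤ 2 * √((n + 1 : ℕ) : ℝ) := by
      intro h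
      rw [Finset.sum_range_succ]
      have := ih.1 (by omega)
      obtain ⟨ha, hb, hb2, ha2, hab⟩ := fact n
      have h1 : min (Q / ((n + 1 : ℕ) : ℝ) ^ 2) (1 / ((n + 1 : ℕ) : ℝ)) * √((n + 1 : ℕ) : ℝ) ≤
          2 * √((n + 1 : ℕ) : ℝ) - 2 * √(n : ℝ) := by
        refine (mul_le_mul_of_nonneg_right (min_le_right _ _) hb.le).trans ?_
        have e : ((n + 1 : ℕ) : ℝ) = √((n + 1 : ℕ) : ℝ) ^ 2 := by rw [hb2]; push_cast; rfl
        set b := √((n + 1 : ℕ) : ℝ)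
        rw [e]
        have : 1 / b ^ 2 * b = 1 / b := by field_simp
        rw [this, div_le_iff₀ hb]
        nlinarith [sq_nonneg (b - √(n : ℝ))]
      linarith
    refine ⟨hF, fun h hQ => ?_⟩
    rcases Nat.eq_or_lt_of_le h with h' | h'
    · have := hF h'.ge
      rw [← h'] at this ⊢
      rw [hQ2 hQ]
      exact this
    · rw [Finset.sum_range_succ]
      have := ih.2 (by omega) hQ
      obtain ⟨ha, hb, hb2, ha2, hab⟩ := fact n
      have ha' : 0 < √(n : ℝ) := Real.sqrt_pos.2 (by exact_mod_cast (by omega : 0 < n))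
      have h1 : min (Q / ((n + 1 : ℕ) : ℝ) ^ 2) (1 / ((n + 1 : ℕ) : ℝ)) * √((n + 1 : ℕ) : ℝ) ≤
          2 * Q / √(n : ℝ) - 2 * Q / √((n + 1 : ℕ) : ℝ) := by
        refine (mul_le_mul_of_nonneg_right (min_le_left _ _) hb.le).trans ?_
        have e : ((n + 1 : ℕ) : ℝ) = √((n + 1 : ℕ) : ℝ) ^ 2 := by rw [hb2]; push_cast; rfl
        set b := √((n + 1 : ℕ) : ℝ)
        set a := √(n : ℝ)
        rw [e, div_sub_div _ _ ha'.ne' hb.ne', div_mul_eq_mul_div,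
          div_le_div_iff₀ (by positivity) (by positivity)]
        have hd : (b - a) * (b + a) = 1 := by nlinarith
        have h3 : a ≤ 2 * (b - a) * b ^ 2 := by
          have : b - a ≥ 0 := by linarith
          have h4 : 1 ≤ (b - a) * (2 * b) := by nlinarith
          nlinarith
        have h5 : 0 ≤ (Q : ℝ) * b ^ 2 := by positivity
        calc (Q : ℝ) * b * (a * b) = Q * b ^ 2 * a := by ring
          _ ≤ Q * b ^ 2 * (2 * (b - a) * b ^ 2) := mul_le_mul_of_nonneg_left h3 h5
          _ = (2 * Q * b - a * (2 * Q)) * (b ^ 2) ^ 2 := by ring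
      linarith

lemma sum_min_mul_sqrt_le' (Q n : ℕ) (hQ : 1 ≤ Q) :
    ∑ k ∈ Finset.range n, min (Q / (k : ℝ) ^ 2) (1 / (k : ℝ)) * √k ≤ 4 * √Q := by
  rcases n with _ | n
  · simp
  rcases le_total n Q with h | h
  · refine ((sum_min_mul_sqrt_le Q n).1 h).trans ?_
    have := Real.sqrt_le_sqrt (Nat.cast_le (α := ℝ).2 h)
    have := Real.sqrt_nonneg (Q : ℝ)
    linarith
  · refine ((sum_min_mul_sqrt_le Q n).2 h hQ).trans ?_
    have : 0 ≤ 2 * Q / √(n : ℝ) := by positivity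
    linarith

lemma sum_min_div_sqrt_le (Q n : ℕ) :
    ∑ k ∈ Finset.range n, min (Q / (k : ℝ) ^ 2) (1 / (k : ℝ)) / √k ≤ 3 := by
  have key : ∀ m : ℕ, ∑ k ∈ Finset.range (m + 2), min (Q / (k : ℝ) ^ 2) (1 / (k : ℝ)) / √k ≤
      3 - 2 / √((m + 1 : ℕ) : ℝ) := by
    intro m
    induction m with
    | zero => simp [Finset.sum_range_succ]; norm_num
    | succ m ih =>
      rw [Finset.sum_range_succ]
      have hb : 0 < √((m + 1 + 1 : ℕ) : ℝ) := Real.sqrt_pos.2 (by positivity)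
      have ha : 0 < √((m + 1 : ℕ) : ℝ) := Real.sqrt_pos.2 (by positivity)
      have hb2 : √((m + 1 + 1 : ℕ) : ℝ) ^ 2 = ((m + 1 + 1 : ℕ) : ℝ) :=
        Real.sq_sqrt (Nat.cast_nonneg _)
      have ha2 : √((m + 1 : ℕ) : ℝ) ^ 2 = ((m + 1 : ℕ) : ℝ) := Real.sq_sqrt (Nat.cast_nonneg _)
      have hab : √((m + 1 : ℕ) : ℝ) ≤ √((m + 1 + 1 : ℕ) : ℝ) :=
        Real.sqrt_le_sqrt (by push_cast; linarith)
      have h1 : min (Q / ((m + 1 + 1 : ℕ) : ℝ) ^ 2) (1 / ((m + 1 + 1 : ℕ) : ℝ))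
          / √((m + 1 + 1 : ℕ) : ℝ) ≤ 2 / √((m + 1 : ℕ) : ℝ) - 2 / √((m + 1 + 1 : ℕ) : ℝ) := by
        refine (div_le_div_of_nonneg_right (min_le_right _ _) hb.le).trans ?_
        have e : √((m + 1 + 1 : ℕ) : ℝ) ^ 2 = √((m + 1 : ℕ) : ℝ) ^ 2 + 1 := by
          rw [hb2, ha2]; push_cast; rfl
        set b := √((m + 1 + 1 : ℕ) : ℝ)
        set a := √((m + 1 : ℕ) : ℝ)
        rw [← hb2, div_sub_div _ _ ha.ne' hb.ne', div_div,
          div_le_div_iff₀ (by positivity) (by positivity)]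
        have hd : (b - a) * (b + a) = 1 := by nlinarith
        have h3 : a ≤ 2 * (b - a) * b ^ 2 := by
          have : b - a ≥ 0 := by linarith
          have h4 : 1 ≤ (b - a) * (2 * b) := by nlinarith
          nlinarith
        nlinarith
      rw [show m + 1 + 1 = m + 2 from rfl] at *
      linarith
  refine (Finset.sum_le_sum_of_subset_of_nonneg (Finset.range_mono (by omega : n ≤ n + 2))
    (fun k _ _ => ?_)).trans ((key n).trans ?_)
  · exact div_nonneg (le_min (by positivity) (by positivity)) (Real.sqrt_nonneg _)
  · have : 0 ≤ 2 / √((n + 1 : ℕ) : ℝ) := by positivity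
    linarith

lemma norm_ePhase_sub_one_le (y : ℝ) : ‖ePhase y - 1‖ ≤ 2 * Real.pi * |y| := by
  have h := Real.norm_exp_I_mul_ofReal_sub_one_le (x := 2 * Real.pi * y)
  rw [ePhase, mul_comm]
  refine h.trans ?_
  rw [Real.norm_eq_abs, abs_mul, abs_of_pos (by positivity : 0 < 2 * Real.pi)]

/-- Mode `k` of the cosine series contributes `|e(kσ) - 1| / k²` times an exponential sum whose
second differences are scaled by `k`. The factor `|e(kσ) - 1|` is at most `2` and at most `2πk / Q`,
which produces the minimum in the preceding sums. -/
lemma abs_sum_periodicBernoulli_sub_le (x : ℕ → ℝ) (N Q : ℕ) (hQ : 1 ≤ Q) {μ σ : ℝ} (hμ : 0 < μ)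
    (hσ : |σ| ≤ 1 / Q)
    (hD : ∀ n < N, μ ≤ secondDiff x n ∧ secondDiff x n ≤ 4 * μ) :
    |∑ i ∈ Finset.range N, (periodicBernoulli (x i + σ) - periodicBernoulli (x i))| ≤
      2 / Q * (80 * N * √μ * √Q + 30 / √μ) := by
  have hQ0 : (0 : ℝ) < Q := by exact_mod_cast hQ
  have hp := Real.pi_pos
  have hs : 0 < √μ := Real.sqrt_pos.2 hμ
  have hsum : HasSum (fun k : ℕ => ∑ i ∈ Finset.range N,
      (1 / (k : ℝ) ^ 2 * Real.cos (2 * Real.pi * (k * (x i + σ))) -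
        1 / (k : ℝ) ^ 2 * Real.cos (2 * Real.pi * (k * x i))))
      (∑ i ∈ Finset.range N, (Real.pi ^ 2 * periodicBernoulli (x i + σ)
        - Real.pi ^ 2 * periodicBernoulli (x i))) :=
    hasSum_sum fun i _ => (hasSum_periodicBernoulli _).sub (hasSum_periodicBernoulli _)
  have hterm : ∀ k : ℕ, |∑ i ∈ Finset.range N,
      (1 / (k : ℝ) ^ 2 * Real.cos (2 * Real.pi * (k * (x i + σ))) -
        1 / (k : ℝ) ^ 2 * Real.cos (2 * Real.pi * (k * x i)))| ≤
      2 * Real.pi / Q * (20 * N * √μ * (min (Q / (k : ℝ) ^ 2) (1 / (k : ℝ)) * √k) +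
        10 / √μ * (min (Q / (k : ℝ) ^ 2) (1 / (k : ℝ)) / √k)) := by
    intro k
    rcases Nat.eq_zero_or_pos k with rfl | hk
    · simp
    have hk0 : (0 : ℝ) < k := by exact_mod_cast hk
    have e : ∑ i ∈ Finset.range N,
      (1 / (k : ℝ) ^ 2 * Real.cos (2 * Real.pi * (k * (x i + σ))) -
        1 / (k : ℝ) ^ 2 * Real.cos (2 * Real.pi * (k * x i))) =
        1 / (k : ℝ) ^ 2 *
          ((ePhase (k * σ) - 1) * ∑ i ∈ Finset.range N, ePhase (k * x i)).re := by
      rw [Finset.mul_sum, Complex.re_sum, Finset.mul_sum]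
      refine Finset.sum_congr rfl fun i _ => ?_
      rw [sub_mul, ← ePhase_add, one_mul, Complex.sub_re, ePhase_re, ePhase_re]
      ring_nf
    have hT : ‖∑ i ∈ Finset.range N, ePhase (k * x i)‖ ≤
        20 * N * (√k * √μ) + 10 / (√k * √μ) := by
      have := norm_sum_ePhase_le_of_secondDiff (fun i => k * x i) N (mul_pos hk0 hμ)
        (fun n hn => ?_)
      · rwa [Real.sqrt_mul hk0.le] at this
      · have h := hD n hn
        have e : secondDiff (fun i => k * x i) n = k * secondDiff x n := by
          unfold secondDiff; ring
        rw [e]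
        constructor <;> nlinarith
    have hE : 1 / (k : ℝ) ^ 2 * ‖ePhase (k * σ) - 1‖ ≤
        2 * Real.pi / Q * min (Q / (k : ℝ) ^ 2) (1 / (k : ℝ)) := by
      rw [mul_min_of_nonneg _ _ (by positivity)]
      apply le_min
      · have h2 : ‖ePhase (k * σ) - 1‖ ≤ 2 := by
          refine (norm_sub_le _ _).trans ?_
          rw [norm_ePhase, norm_one]; norm_num
        have h3 : ‖ePhase (k * σ) - 1‖ ≤ 2 * Real.pi := by linarith [Real.pi_gt_three]
        calc 1 / (k : ℝ) ^ 2 * ‖ePhase (k * σ) - 1‖ ≤ 1 / (k : ℝ) ^ 2 * (2 * Real.pi) := by gcongr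
          _ = _ := by field_simp
      · have h2 := norm_ePhase_sub_one_le (k * σ)
        rw [abs_mul, abs_of_pos hk0] at h2
        calc 1 / (k : ℝ) ^ 2 * ‖ePhase (k * σ) - 1‖
            ≤ 1 / (k : ℝ) ^ 2 * (2 * Real.pi * (k * (1 / Q))) := by
              refine mul_le_mul_of_nonneg_left (h2.trans ?_) (by positivity)
              gcongr
          _ = _ := by field_simp
    rw [e, abs_mul, abs_of_pos (by positivity : 0 < 1 / (k : ℝ) ^ 2)]
    have h1 := Complex.abs_re_le_norm
      ((ePhase (k * σ) - 1) * ∑ i ∈ Finset.range N, ePhase (k * x i))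
    rw [norm_mul] at h1
    calc _ ≤ 1 / (k : ℝ) ^ 2 * (‖ePhase (k * σ) - 1‖ *
            ‖∑ i ∈ Finset.range N, ePhase (k * x i)‖) := by gcongr
      _ = 1 / (k : ℝ) ^ 2 * ‖ePhase (k * σ) - 1‖ *
            ‖∑ i ∈ Finset.range N, ePhase (k * x i)‖ := by ring
      _ ≤ 2 * Real.pi / Q * min (Q / (k : ℝ) ^ 2) (1 / (k : ℝ)) *
          (20 * N * (√k * √μ) + 10 / (√k * √μ)) := by
            gcongr
      _ = _ := by
        field_simp
  have hlim := (hsum.tendsto_sum_nat).abs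
  have hbound : |∑ i ∈ Finset.range N, (Real.pi ^ 2 * periodicBernoulli (x i + σ)
        - Real.pi ^ 2 * periodicBernoulli (x i))| ≤
        2 * Real.pi / Q * (20 * N * √μ * (4 * √Q) + 10 / √μ * 3) := by
    refine le_of_tendsto hlim (Eventually.of_forall fun n => ?_)
    refine (Finset.abs_sum_le_sum_abs _ _).trans ((Finset.sum_le_sum fun k _ => hterm k).trans ?_)
    rw [← Finset.mul_sum, Finset.sum_add_distrib, ← Finset.mul_sum, ← Finset.mul_sum]
    have h1 := sum_min_mul_sqrt_le' Q n hQ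
    have h2 := sum_min_div_sqrt_le Q n
    gcongr
  have e : ∑ i ∈ Finset.range N, (Real.pi ^ 2 * periodicBernoulli (x i + σ)
        - Real.pi ^ 2 * periodicBernoulli (x i)) = Real.pi ^ 2 *
        ∑ i ∈ Finset.range N, (periodicBernoulli (x i + σ) - periodicBernoulli (x i)) := by
    rw [Finset.mul_sum]
    exact Finset.sum_congr rfl fun i _ => by ring
  rw [e, abs_mul, abs_of_pos (by positivity)] at hbound
  have hfin : 2 * Real.pi / Q * (20 * N * √μ * (4 * √Q) + 10 / √μ * 3) ≤
      Real.pi ^ 2 * (2 / Q * (80 * N * √μ * √Q + 30 / √μ)) := by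
    have h3 : 0 ≤ 2 / Q * (80 * N * √μ * √Q + 30 / √μ) := by positivity
    calc _ = Real.pi * (2 / Q * (80 * N * √μ * √Q + 30 / √μ)) := by ring
      _ ≤ _ := by
        refine mul_le_mul_of_nonneg_right ?_ h3
        nlinarith [Real.pi_gt_three]
  exact le_of_mul_le_mul_left (hbound.trans hfin) (by positivity)

lemma abs_sum_saw_le_card (x : ℕ → ℝ) (N : ℕ) : |∑ n ∈ Finset.range N, saw (x n)| ≤ N / 2 := by
  refine (Finset.abs_sum_le_sum_abs _ _).trans ((Finset.sum_le_sum fun k _ => abs_saw_le _).trans ?_)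
  rw [Finset.sum_const, Finset.card_range, nsmul_eq_mul]
  exact le_of_eq (by ring)

/-- The bound `N μ^(1/3) + μ^(-1/2)`, with `μ = τ^6` so that no fractional powers appear. -/
lemma abs_sum_saw_le_of_secondDiff (x : ℕ → ℝ) (N : ℕ) {τ : ℝ} (hτ : 0 < τ)
    (hD : ∀ n < N, τ ^ 6 ≤ secondDiff x n ∧ secondDiff x n ≤ 4 * τ ^ 6) :
    |∑ n ∈ Finset.range N, saw (x n)| ≤ 121 * (N * τ ^ 2 + 1 / τ ^ 3) := by
  have hN : (0 : ℝ) ≤ N := Nat.cast_nonneg N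
  rcases le_total 1 τ with h | h
  · refine (abs_sum_saw_le_card x N).trans ?_
    have : 0 ≤ 1 / τ ^ 3 := by positivity
    have : 1 ≤ τ ^ 2 := one_le_pow₀ h
    nlinarith
  -- With difference step `1 / Q` of order `τ²`, the smoothing error `N / Q` and the oscillatory
  -- term `N √μ √Q` are both of order `N τ²`.
  set Q := ⌈1 / τ ^ 2⌉₊ with hQdef
  have hQ1 : 1 / τ ^ 2 ≤ Q := Nat.le_ceil _
  have hone : 1 ≤ 1 / τ ^ 2 := by
    rw [le_div_iff₀ (by positivity)]; nlinarith
  have hQ2 : (Q : ℝ) ≤ 2 / τ ^ 2 := by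
    have := (Nat.ceil_lt_add_one (by positivity : 0 ≤ 1 / τ ^ 2)).le
    have e : 2 / τ ^ 2 = 2 * (1 / τ ^ 2) := by ring
    rw [e]; linarith
  have hQ : 1 ≤ Q := by
    have : (1 : ℝ) ≤ Q := hone.trans hQ1
    exact_mod_cast this
  have hQ0 : (0 : ℝ) < Q := by exact_mod_cast hQ
  have hQle : 1 / (Q : ℝ) ≤ 1 := by
    rw [div_le_one hQ0]; exact_mod_cast hQ
  have hsq : √(τ ^ 6) = τ ^ 3 := by
    rw [show τ ^ 6 = (τ ^ 3) ^ 2 by ring, Real.sqrt_sq (by positivity)]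
  have hsQ : √(Q : ℝ) ≤ 3 / 2 / τ := by
    rw [Real.sqrt_le_left (by positivity)]
    refine hQ2.trans ?_
    rw [div_pow, div_pow]
    gcongr
    norm_num
  have hinv : 1 / (Q : ℝ) ≤ τ ^ 2 := by
    rw [div_le_iff₀ hQ0]
    rw [div_le_iff₀ (by positivity)] at hQ1
    linarith
  have bound : ∀ σ : ℝ, |σ| ≤ 1 / Q →
      |∑ i ∈ Finset.range N, (periodicBernoulli (x i + σ) - periodicBernoulli (x i))|
        / (2 * (1 / Q)) ≤ 120 * (N * τ ^ 2 + 1 / τ ^ 3) := by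
    intro σ hσ
    have h1 := abs_sum_periodicBernoulli_sub_le x N Q hQ (by positivity) hσ hD
    rw [hsq] at h1
    rw [div_le_iff₀ (by positivity)]
    refine h1.trans ?_
    have h2 : 80 * N * τ ^ 3 * √Q ≤ 119 * (N * τ ^ 2) + N * τ ^ 2 := by
      calc 80 * N * τ ^ 3 * √Q ≤ 80 * N * τ ^ 3 * (3 / 2 / τ) := by gcongr
        _ = _ := by field_simp; ring
    have h3 : 80 * N * τ ^ 3 * √Q + 30 / τ ^ 3 ≤ 120 * (N * τ ^ 2 + 1 / τ ^ 3) := by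
      have : 0 < 1 / τ ^ 3 := by positivity
      have e : 30 / τ ^ 3 = 30 * (1 / τ ^ 3) := by ring
      rw [e]; linarith
    calc _ ≤ 2 / Q * (120 * (N * τ ^ 2 + 1 / τ ^ 3)) := by gcongr
      _ = _ := by ring
  have b0 : 0 < 1 / τ ^ 3 := by positivity
  have b1 : N * (1 / Q / 2) ≤ N * τ ^ 2 / 2 := by nlinarith
  have b2 : 0 ≤ N * τ ^ 2 := by positivity
  rw [abs_le]
  constructor
  · have h1 := bound (1 / Q) (abs_of_pos (by positivity)).le
    have h2 : ∑ n ∈ Finset.range N, ((periodicBernoulli (x n + 1 / Q) - periodicBernoulli (x n))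
        / (2 * (1 / Q)) - 1 / Q / 2) ≤ ∑ n ∈ Finset.range N, saw (x n) :=
      Finset.sum_le_sum fun n _ => le_saw (by positivity) hQle (x n)
    rw [Finset.sum_sub_distrib, ← Finset.sum_div, Finset.sum_const, Finset.card_range,
      nsmul_eq_mul] at h2
    have h3 := neg_abs_le (∑ i ∈ Finset.range N,
      (periodicBernoulli (x i + 1 / Q) - periodicBernoulli (x i)))
    have h4 := div_le_div_of_nonneg_right h3 (by positivity : 0 ≤ 2 * (1 / (Q : ℝ)))
    rw [neg_div] at h4
    linarith
  · have h1 := bound (-(1 / Q)) (by rw [abs_neg]; exact (abs_of_pos (by positivity)).le)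
    have h2 : ∑ n ∈ Finset.range N, saw (x n) ≤
        ∑ n ∈ Finset.range N, ((periodicBernoulli (x n) - periodicBernoulli (x n - 1 / Q))
        / (2 * (1 / Q)) + 1 / Q / 2) :=
      Finset.sum_le_sum fun n _ => saw_le (by positivity) hQle (x n)
    rw [Finset.sum_add_distrib, ← Finset.sum_div, Finset.sum_const, Finset.card_range,
      nsmul_eq_mul] at h2
    have h3 := neg_abs_le (∑ i ∈ Finset.range N,
      (periodicBernoulli (x i + -(1 / Q)) - periodicBernoulli (x i)))
    have h4 := div_le_div_of_nonneg_right h3 (by positivity : 0 ≤ 2 * (1 / (Q : ℝ)))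
    have e : ∑ n ∈ Finset.range N, (periodicBernoulli (x n) - periodicBernoulli (x n - 1 / Q)) =
      - ∑ i ∈ Finset.range N,
      (periodicBernoulli (x i + -(1 / Q)) - periodicBernoulli (x i)) := by
      rw [← Finset.sum_neg_distrib]
      exact Finset.sum_congr rfl fun i _ => by rw [← sub_eq_add_neg]; ring
    rw [e, neg_div] at h2
    rw [neg_div] at h4
    linarith

/-- Used with `z³` a second difference: it replaces a cube root by a linear expression, so that
second differences can be summed by telescoping. -/
lemma le_add_cube_div_sq {z σ : ℝ} (hσ : 0 < σ) (hz : 0 ≤ z) : z ≤ σ + z ^ 3 / σ ^ 2 := by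
  rcases le_total z σ with h | h
  · have : 0 ≤ z ^ 3 / σ ^ 2 := by positivity
    linarith
  · have : z ≤ z ^ 3 / σ ^ 2 := by
      rw [le_div_iff₀ (by positivity)]
      have : σ ^ 2 ≤ z ^ 2 := by gcongr
      nlinarith
    linarith

/-- Cut off the final block where the second differences are at most `4` times the last one, `ρ^6`,
and recurse on the initial segment. There the lower bound has grown by a factor `4`, so the terms `1
/ τ³` halve and their sum is geometric. -/
lemma abs_sum_saw_le_of_antitone (x : ℕ → ℝ) {σ : ℝ} (hσ : 0 < σ) (N : ℕ) :
    ∀ τ : ℝ, 0 < τ → (∀ n < N, τ ^ 6 ≤ secondDiff x n) →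
    (∀ n, n + 1 < N → secondDiff x (n + 1) ≤ secondDiff x n) →
    |∑ n ∈ Finset.range N, saw (x n)| ≤
      121 * (∑ n ∈ Finset.range N, (σ + secondDiff x n / σ ^ 2) + 2 / τ ^ 3) := by
  induction N using Nat.strong_induction_on with
  | _ N ih =>
  intro τ hτ hμ hanti
  rcases N with _ | K
  · simp; positivity
  obtain ⟨ρ, hρ, hρD⟩ : ∃ ρ : ℝ, 0 ≤ ρ ∧ ρ ^ 6 = secondDiff x K := by
    have h0 : 0 ≤ secondDiff x K := le_trans (by positivity) (hμ K (by omega))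
    refine ⟨secondDiff x K ^ ((1 : ℝ) / 6), Real.rpow_nonneg h0 _, ?_⟩
    rw [← Real.rpow_natCast, ← Real.rpow_mul h0]
    norm_num
  have hτρ : τ ≤ ρ := by
    refine le_of_pow_le_pow_left₀ (n := 6) (by norm_num) hρ ?_
    rw [hρD]; exact hμ K (by omega)
  have hρ0 : 0 < ρ := hτ.trans_le hτρ
  obtain ⟨i, hi, hi1, hi2⟩ := exists_threshold (fun n => -secondDiff x n) (K + 1) (-(4 * ρ ^ 6))
    (fun n hn => neg_le_neg (hanti n hn))
  have hiK : i ≤ K := by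
    by_contra h
    have := hi1 K (by omega)
    have h6 : 0 < ρ ^ 6 := by positivity
    rw [← hρD] at this
    linarith
  have hle : ∀ n ≤ K, secondDiff x K ≤ secondDiff x n := by
    intro n hn
    induction hn using Nat.decreasingInduction with
    | self => rfl
    | of_succ k hk ih => exact ih.trans (hanti k (by omega))
  obtain ⟨p, hp⟩ := Nat.exists_eq_add_of_le hi
  have A : |∑ n ∈ Finset.range p, saw (x (i + n))| ≤ 121 * (p * ρ ^ 2 + 1 / ρ ^ 3) := by
    refine abs_sum_saw_le_of_secondDiff (fun n => x (i + n)) p hρ0 (fun n hn => ⟨?_, ?_⟩)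
    · rw [hρD]; exact hle (i + n) (by omega)
    · have := hi2 (i + n) (by omega) (by omega)
      exact le_of_neg_le_neg this
  have A2 : (p : ℝ) * ρ ^ 2 ≤ ∑ n ∈ Finset.range p, (σ + secondDiff x (i + n) / σ ^ 2) := by
    have : (p : ℝ) * ρ ^ 2 = ∑ n ∈ Finset.range p, ρ ^ 2 := by simp
    rw [this]
    refine Finset.sum_le_sum fun n hn => ?_
    refine (le_add_cube_div_sq hσ (by positivity)).trans ?_
    have : (ρ ^ 2) ^ 3 ≤ secondDiff x (i + n) := by
      rw [← pow_mul, hρD]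
      exact hle _ (by have := Finset.mem_range.1 hn; omega)
    gcongr
  obtain ⟨τ', hτ', h6⟩ : ∃ τ' : ℝ, 0 < τ' ∧ τ' ^ 6 = 4 * ρ ^ 6 := by
    refine ⟨4 ^ ((1 : ℝ) / 6) * ρ, by positivity, ?_⟩
    rw [mul_pow, ← Real.rpow_natCast, ← Real.rpow_mul (by norm_num)]
    norm_num
  have h3 : τ' ^ 3 = 2 * ρ ^ 3 := by
    refine (pow_left_inj₀ (by positivity) (by positivity) (two_ne_zero)).1 ?_
    rw [← pow_mul, h6]; ring
  have hlast : 1 / ρ ^ 3 ≤ 1 / τ ^ 3 := by gcongr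
  have B := ih i (by omega) τ' hτ'
    (fun n hn => by
      have := hi1 n hn
      rw [h6]; exact (lt_of_neg_lt_neg this).le)
    (fun n hn => hanti n (by omega))
  rw [h3] at B
  have e1 : 2 / (2 * ρ ^ 3) = 1 / ρ ^ 3 := by field_simp
  have e2 : 2 / τ ^ 3 = 2 * (1 / τ ^ 3) := by ring
  rw [e1] at B
  rw [hp, Finset.sum_range_add, Finset.sum_range_add, e2]
  refine (abs_add_le _ _).trans ?_
  linarith

/-- Reversal of the sequence. The second differences with index below `N` involve `N + 2` terms, so
the reversed sum over `N` terms differs from the original one by four sawtooth values, which cost at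
most `2`. -/
lemma abs_sum_saw_le_of_monotone (x : ℕ → ℝ) {σ τ : ℝ} (hσ : 0 < σ) (N : ℕ) (hτ : 0 < τ)
    (hμ : ∀ n < N, τ ^ 6 ≤ secondDiff x n)
    (hmono : ∀ n, n + 1 < N → secondDiff x n ≤ secondDiff x (n + 1)) :
    |∑ n ∈ Finset.range N, saw (x n)| ≤
      121 * (∑ n ∈ Finset.range N, (σ + secondDiff x n / σ ^ 2) + 2 / τ ^ 3) + 2 := by
  have hD : ∀ n < N, secondDiff (fun n => x (N + 1 - n)) n = secondDiff x (N - 1 - n) := by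
    intro n hn
    simp only [secondDiff]
    rw [show N + 1 - (n + 2) = N - 1 - n by omega, show N + 1 - (n + 1) = N - 1 - n + 1 by omega,
      show N + 1 - n = N - 1 - n + 2 by omega]
    ring
  have h := abs_sum_saw_le_of_antitone (fun n => x (N + 1 - n)) hσ N τ hτ
    (fun n hn => by rw [hD n hn]; exact hμ _ (by omega))
    (fun n hn => by
      rw [hD n (by omega), hD (n + 1) hn]
      have := hmono (N - 1 - (n + 1)) (by omega)
      rwa [show N - 1 - (n + 1) + 1 = N - 1 - n by omega] at this)
  have e1 : ∑ n ∈ Finset.range N, (σ + secondDiff (fun n => x (N + 1 - n)) n / σ ^ 2) =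
      ∑ n ∈ Finset.range N, (σ + secondDiff x n / σ ^ 2) := by
    rw [← Finset.sum_range_reflect (fun n => σ + secondDiff x n / σ ^ 2)]
    exact Finset.sum_congr rfl fun n hn => by rw [hD n (Finset.mem_range.1 hn)]
  have e2 : ∑ n ∈ Finset.range (N + 2), saw (x (N + 1 - n)) =
      ∑ n ∈ Finset.range (N + 2), saw (x n) := by
    rw [← Finset.sum_range_reflect (fun n => saw (x n))]
    refine Finset.sum_congr rfl fun n hn => ?_
    rw [show N + 2 - 1 - n = N + 1 - n by omega]
  rw [Finset.sum_range_succ, Finset.sum_range_succ, Finset.sum_range_succ,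
    Finset.sum_range_succ _ N] at e2
  have a1 := abs_le.1 (abs_saw_le (x (N + 1 - N)))
  have a2 := abs_le.1 (abs_saw_le (x (N + 1 - (N + 1))))
  have a3 := abs_le.1 (abs_saw_le (x N))
  have a4 := abs_le.1 (abs_saw_le (x (N + 1)))
  rw [e1] at h
  have h' := abs_le.1 h
  rw [abs_le]
  constructor <;> linarith

/-- Sawtooth sums along a sequence with positive and monotonic second differences. -/
lemma abs_sum_saw_le (x : ℕ → ℝ) {σ τ V : ℝ} (hσ : 0 < σ) (N : ℕ) (hτ : 0 < τ)
    (hμ : ∀ n < N, τ ^ 6 ≤ secondDiff x n)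
    (hmono : (∀ n, n + 1 < N → secondDiff x n ≤ secondDiff x (n + 1)) ∨
      (∀ n, n + 1 < N → secondDiff x (n + 1) ≤ secondDiff x n))
    (hV : (x (N + 1) - x N) - (x 1 - x 0) ≤ V) :
    |∑ n ∈ Finset.range N, saw (x n)| ≤ 121 * (N * σ + V / σ ^ 2 + 2 / τ ^ 3) + 2 := by
  have key : |∑ n ∈ Finset.range N, saw (x n)| ≤
      121 * (∑ n ∈ Finset.range N, (σ + secondDiff x n / σ ^ 2) + 2 / τ ^ 3) + 2 := by
    rcases hmono with h | h
    · exact abs_sum_saw_le_of_monotone x hσ N hτ hμ h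
    · exact (abs_sum_saw_le_of_antitone x hσ N τ hτ hμ h).trans (by linarith)
  have tele : ∀ K, ∑ n ∈ Finset.range K, secondDiff x n = (x (K + 1) - x K) - (x 1 - x 0) := by
    intro K
    induction K with
    | zero => simp
    | succ K ih =>
      rw [Finset.sum_range_succ, ih, secondDiff]
      ring
  rw [Finset.sum_add_distrib, ← Finset.sum_div, tele, Finset.sum_const, Finset.card_range,
    nsmul_eq_mul] at key
  have : ((x (N + 1) - x N) - (x 1 - x 0)) / σ ^ 2 ≤ V / σ ^ 2 := by gcongr
  linarith

/-! ### The inverse curve, and splitting the count and the area at a point. -/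

namespace IsConvexDecreasingCurve

variable {f : ℝ → ℝ} {L M : ℝ}

lemma image_eq (h : IsConvexDecreasingCurve f L M) : f '' Icc 0 L = Icc 0 M := by
  have hL := h.L_pos.le
  apply Subset.antisymm
  · rintro _ ⟨x, hx, rfl⟩
    constructor
    · rw [← h.map_L]
      exact h.strictAnti.antitoneOn hx (right_mem_Icc.2 hL) hx.2
    · rw [← h.map_zero]
      exact h.strictAnti.antitoneOn (left_mem_Icc.2 hL) hx hx.1
  · have := intermediate_value_Icc' hL h.continuous
    rwa [h.map_zero, h.map_L] at this

lemma map_mem (h : IsConvexDecreasingCurve f L M) {x : ℝ} (hx : x ∈ Icc 0 L) :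
    f x ∈ Icc 0 M := by
  rw [← h.image_eq]; exact mem_image_of_mem f hx

lemma inverse_mem (h : IsConvexDecreasingCurve f L M) {y : ℝ} (hy : y ∈ Icc 0 M) :
    curveInverse f L y ∈ Icc 0 L := by
  rw [← h.image_eq] at hy
  exact Function.invFunOn_mem hy

lemma apply_inverse (h : IsConvexDecreasingCurve f L M) {y : ℝ} (hy : y ∈ Icc 0 M) :
    f (curveInverse f L y) = y := by
  rw [← h.image_eq] at hy
  exact Function.invFunOn_eq hy

lemma inverse_apply (h : IsConvexDecreasingCurve f L M) {x : ℝ} (hx : x ∈ Icc 0 L) :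
    curveInverse f L (f x) = x :=
  h.strictAnti.injOn (h.inverse_mem (h.map_mem hx)) hx (h.apply_inverse (h.map_mem hx))

/-- Both sides describe the region under the curve, seen from either axis. -/
lemma le_apply_iff (h : IsConvexDecreasingCurve f L M) {x y : ℝ} (hx : 0 ≤ x) (hy : 0 ≤ y) :
    (x ≤ L ∧ y ≤ f x) ↔ (y ≤ M ∧ x ≤ curveInverse f L y) := by
  constructor
  · rintro ⟨h1, h2⟩
    have hM := (h.map_mem ⟨hx, h1⟩).2
    have hy' : y ∈ Icc 0 M := ⟨hy, h2.trans hM⟩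
    refine ⟨hy'.2, ?_⟩
    rw [← h.strictAnti.le_iff_ge (h.inverse_mem hy') ⟨hx, h1⟩, h.apply_inverse hy']
    exact h2
  · rintro ⟨h1, h2⟩
    have hy' : y ∈ Icc 0 M := ⟨hy, h1⟩
    have hx' : x ∈ Icc 0 L := ⟨hx, h2.trans (h.inverse_mem hy').2⟩
    refine ⟨hx'.2, ?_⟩
    rw [← h.apply_inverse hy', h.strictAnti.le_iff_ge (h.inverse_mem hy') hx']
    exact h2

lemma lt_apply_iff (h : IsConvexDecreasingCurve f L M) {x y : ℝ} (hx : x ∈ Icc 0 L)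
    (hy : y ∈ Icc 0 M) : y < f x ↔ x < curveInverse f L y := by
  conv_lhs => rw [← h.apply_inverse hy]
  exact h.strictAnti.lt_iff_gt (h.inverse_mem hy) hx

/-- The inverse of a convex decreasing curve is a convex decreasing curve. -/
lemma inverse (h : IsConvexDecreasingCurve f L M) :
    IsConvexDecreasingCurve (curveInverse f L) M L where
  L_pos := h.M_pos
  M_pos := h.L_pos
  convex := by
    refine ⟨convex_Icc _ _, fun y₁ h₁ y₂ h₂ a b ha hb hab => ?_⟩
    have hc := convex_Icc 0 L (h.inverse_mem h₁) (h.inverse_mem h₂) ha hb hab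
    have hc' := convex_Icc 0 M h₁ h₂ ha hb hab
    rw [← h.strictAnti.le_iff_ge hc (h.inverse_mem hc'), h.apply_inverse hc']
    have := h.convex.2 (h.inverse_mem h₁) (h.inverse_mem h₂) ha hb hab
    rwa [h.apply_inverse h₁, h.apply_inverse h₂] at this
  strictAnti := by
    intro y₁ h₁ y₂ h₂ hlt
    rw [← h.lt_apply_iff (h.inverse_mem h₂) h₁, h.apply_inverse h₂]
    exact hlt
  continuous := by
    -- The preimage of a closed set under the inverse is the image under `f` of a compact set.
    rw [continuousOn_iff_isClosed]
    intro t ht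
    refine ⟨f '' (Icc 0 L ∩ t), ((isCompact_Icc.inter_right ht).image_of_continuousOn
      (h.continuous.mono inter_subset_left)).isClosed, ?_⟩
    ext y
    constructor
    · rintro ⟨h1, h2⟩
      exact ⟨⟨_, ⟨h.inverse_mem h2, h1⟩, h.apply_inverse h2⟩, h2⟩
    · rintro ⟨⟨x, ⟨hx, hxt⟩, rfl⟩, h2⟩
      refine ⟨?_, h2⟩
      rw [mem_preimage, h.inverse_apply hx]
      exact hxt
  map_zero := by
    rw [← h.map_L, h.inverse_apply (right_mem_Icc.2 h.L_pos.le)]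
  map_L := by
    rw [← h.map_zero, h.inverse_apply (left_mem_Icc.2 h.L_pos.le)]

/-- The first-quadrant lattice points under the stretched curve. -/
def latticeSet (f : ℝ → ℝ) (L r s : ℝ) : Set (ℕ × ℕ) :=
  {p : ℕ × ℕ | 0 < p.1 ∧ 0 < p.2 ∧ (p.1 : ℝ) * s / r ≤ L ∧
    (p.2 : ℝ) ≤ r * s * f ((p.1 : ℝ) * s / r)}

lemma latticeSet_inter_eq (f : ℝ → ℝ) (L : ℝ) {r s a : ℝ} (hr : 0 < r) (hs : 0 < s)
    (ha : 0 ≤ a) :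
    {p ∈ latticeSet f L r s | a < p.1} =
      (((Finset.Ioc ⌊a⌋₊ ⌊r * L / s⌋₊).sigma
        fun j => Finset.Ioc 0 ⌊r * s * f ((j : ℝ) * s / r)⌋₊).map
          (Equiv.sigmaEquivProd ℕ ℕ).toEmbedding : Finset (ℕ × ℕ)) := by
  ext ⟨j, k⟩
  simp only [latticeSet, mem_ofPred_eq, Finset.coe_map, mem_image, Finset.mem_coe,
    Finset.mem_sigma, Finset.mem_Ioc, Sigma.exists]
  constructor
  · rintro ⟨⟨h1, h2, h3, h4⟩, h5⟩
    refine ⟨j, k, ⟨⟨(Nat.floor_lt ha).2 h5, Nat.le_floor ?_⟩, h2, Nat.le_floor h4⟩, rfl⟩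
    rw [le_div_iff₀ hs]
    rw [div_le_iff₀ hr] at h3
    linarith
  · rintro ⟨j', k', ⟨⟨h1, h2⟩, h3, h4⟩, h5⟩
    obtain ⟨rfl, rfl⟩ : j' = j ∧ k' = k := by simpa using h5
    have h2' := (Nat.le_floor_iff' (by omega)).1 h2
    refine ⟨⟨by omega, h3, ?_, (Nat.le_floor_iff' (by omega)).1 h4⟩, (Nat.floor_lt ha).1 h1⟩
    rw [le_div_iff₀ hs] at h2'
    rw [div_le_iff₀ hr]
    linarith

lemma ncard_latticeSet_inter (f : ℝ → ℝ) (L : ℝ) {r s a : ℝ} (hr : 0 < r) (hs : 0 < s)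
    (ha : 0 ≤ a) :
    {p ∈ latticeSet f L r s | a < p.1}.ncard =
      ∑ j ∈ Finset.Ioc ⌊a⌋₊ ⌊r * L / s⌋₊, ⌊r * s * f ((j : ℝ) * s / r)⌋₊ := by
  rw [latticeSet_inter_eq f L hr hs ha, Set.ncard_coe_finset, Finset.card_map, Finset.card_sigma]
  simp

lemma latticeSet_finite (f : ℝ → ℝ) (L : ℝ) {r s : ℝ} (hr : 0 < r) (hs : 0 < s) :
    (latticeSet f L r s).Finite := by
  have : latticeSet f L r s = {p ∈ latticeSet f L r s | (0 : ℝ) < p.1} := by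
    ext p
    simp only [latticeSet, mem_ofPred_eq, Nat.cast_pos]
    tauto
  rw [this, latticeSet_inter_eq f L hr hs le_rfl]
  exact Finset.finite_toSet _

lemma latticeCount_eq_sum (f : ℝ → ℝ) (L : ℝ) {r s : ℝ} (hr : 0 < r) (hs : 0 < s) :
    latticeCount f L r s =
      ∑ j ∈ Finset.Ioc 0 ⌊r * L / s⌋₊, ⌊r * s * f ((j : ℝ) * s / r)⌋₊ := by
  have := ncard_latticeSet_inter f L hr hs le_rfl
  rw [Nat.floor_zero] at this
  rw [← this]
  unfold latticeCount latticeSet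
  congr 1
  ext p
  simp only [mem_ofPred_eq, Nat.cast_pos]
  tauto

lemma latticeSet_inverse (h : IsConvexDecreasingCurve f L M) {r s : ℝ} (hr : 0 < r) (hs : 0 < s) :
    latticeSet (curveInverse f L) M r s⁻¹ = Prod.swap '' latticeSet f L r s := by
  ext ⟨k, j⟩
  rw [Set.image_swap_eq_preimage_swap]
  simp only [latticeSet, mem_ofPred_eq, mem_preimage, Prod.swap]
  have key := h.le_apply_iff (x := j * s / r) (y := k * s⁻¹ / r) (by positivity) (by positivity)
  have e1 : (k : ℝ) ≤ r * s * f (j * s / r) ↔ k * s⁻¹ / r ≤ f (j * s / r) := by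
    rw [div_le_iff₀ hr, mul_inv_le_iff₀ hs]
    constructor <;> intro <;> linarith
  have e2 : (j : ℝ) ≤ r * s⁻¹ * curveInverse f L (k * s⁻¹ / r) ↔
      j * s / r ≤ curveInverse f L (k * s⁻¹ / r) := by
    rw [div_le_iff₀ hr, ← le_div_iff₀ hs]
    have : curveInverse f L (k * s⁻¹ / r) * r / s = r * s⁻¹ * curveInverse f L (k * s⁻¹ / r) := by
      field_simp
    rw [this]
  rw [e1, e2]
  tauto

lemma latticeCount_inverse (h : IsConvexDecreasingCurve f L M) {r s : ℝ} (hr : 0 < r)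
    (hs : 0 < s) : latticeCount (curveInverse f L) M r s⁻¹ = latticeCount f L r s := by
  have := congrArg Set.ncard (h.latticeSet_inverse hr hs)
  rw [Set.ncard_image_of_injective _ Prod.swap_injective] at this
  exact this

/-- Counting to the right of `α`, above `f α`, and in the remaining rectangle. -/
lemma latticeCount_split (h : IsConvexDecreasingCurve f L M) {r s α : ℝ} (hr : 0 < r)
    (hs : 0 < s) (hα : α ∈ Icc 0 L) :
    latticeCount f L r s =
      ∑ j ∈ Finset.Ioc ⌊r * α / s⌋₊ ⌊r * L / s⌋₊, ⌊r * s * f ((j : ℝ) * s / r)⌋₊ +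
      ∑ k ∈ Finset.Ioc ⌊r * f α / s⁻¹⌋₊ ⌊r * M / s⁻¹⌋₊,
        ⌊r * s⁻¹ * curveInverse f L ((k : ℝ) * s⁻¹ / r)⌋₊ +
      ⌊r * α / s⌋₊ * ⌊r * f α / s⁻¹⌋₊ := by
  have hs' : 0 < s⁻¹ := inv_pos.2 hs
  have hβ := h.map_mem hα
  have a0 : 0 ≤ r * α / s := div_nonneg (mul_nonneg hr.le hα.1) hs.le
  have b0 : 0 ≤ r * f α / s⁻¹ := div_nonneg (mul_nonneg hr.le hβ.1) hs'.le
  rw [← ncard_latticeSet_inter f L hr hs a0, ← ncard_latticeSet_inter _ M hr hs' b0]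
  have e2 : {p ∈ latticeSet (curveInverse f L) M r s⁻¹ | r * f α / s⁻¹ < p.1} =
      Prod.swap '' {p ∈ latticeSet f L r s | r * f α / s⁻¹ < p.2} := by
    rw [h.latticeSet_inverse hr hs, Set.image_swap_eq_preimage_swap]
    rfl
  rw [e2, Set.ncard_image_of_injective _ Prod.swap_injective]
  set A := {p ∈ latticeSet f L r s | r * α / s < p.1} with hA
  set B := {p ∈ latticeSet f L r s | r * f α / s⁻¹ < p.2} with hB
  have fin := latticeSet_finite f L hr hs
  have finA : A.Finite := fin.subset (sep_subset _ _)
  have finB : B.Finite := fin.subset (sep_subset _ _)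
  have hdiv : ∀ j : ℕ, (j : ℝ) ≤ r * α / s ↔ j * s / r ≤ α := fun j => by
    rw [le_div_iff₀ hs, div_le_iff₀ hr, mul_comm r]
  have hk : ∀ k : ℕ, (k : ℝ) ≤ r * f α / s⁻¹ ↔ k ≤ r * s * f α := fun k => by
    rw [div_inv_eq_mul]; constructor <;> intro <;> linarith
  -- Since `f` decreases, the whole rectangle with corner `(α, f α)` lies under the curve.
  have hC : ((Finset.Ioc 0 ⌊r * α / s⌋₊ ×ˢ Finset.Ioc 0 ⌊r * f α / s⁻¹⌋₊ : Finset (ℕ × ℕ)) :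
      Set (ℕ × ℕ)) = {p ∈ latticeSet f L r s | p.1 ≤ r * α / s ∧ p.2 ≤ r * f α / s⁻¹} := by
    ext ⟨j, k⟩
    simp only [Finset.coe_product, mem_prod, Finset.coe_Ioc, mem_Ioc, mem_ofPred_eq, latticeSet,
      Nat.le_floor_iff a0, Nat.le_floor_iff b0]
    constructor
    · rintro ⟨⟨h1, h2⟩, h3, h4⟩
      have h2' := (hdiv j).1 h2
      have h0 : 0 ≤ (j : ℝ) * s / r := by positivity
      refine ⟨⟨h1, h3, h2'.trans hα.2, ?_⟩, h2, h4⟩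
      refine ((hk k).1 h4).trans ?_
      exact mul_le_mul_of_nonneg_left
        (h.strictAnti.antitoneOn ⟨h0, h2'.trans hα.2⟩ hα h2') (by positivity)
    · rintro ⟨⟨h1, h2, _, _⟩, h3, h4⟩
      exact ⟨⟨h1, h3⟩, h2, h4⟩
  have hAB : Disjoint A B := by
    rw [Set.disjoint_left]
    rintro ⟨j, k⟩ ⟨⟨h1, h2, h3, h4⟩, h5⟩ ⟨_, h6⟩
    simp only at h3 h4 h5 h6
    have h5' : α < j * s / r := by
      rw [← not_le] at h5 ⊢
      exact fun h' => h5 ((hdiv j).2 h')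
    have h7 := h.strictAnti hα ⟨hα.1.trans h5'.le, h3⟩ h5'
    have h8 : r * s * f (j * s / r) < r * s * f α := by gcongr
    exact absurd ((hk k).2 (h4.trans h8.le)) (not_le.2 h6)
  have hunion : latticeSet f L r s = (A ∪ B) ∪
      {p ∈ latticeSet f L r s | p.1 ≤ r * α / s ∧ p.2 ≤ r * f α / s⁻¹} := by
    ext p
    simp only [hA, hB, mem_union, mem_ofPred_eq, ← not_lt]
    tauto
  have hdis : Disjoint (A ∪ B)
      {p ∈ latticeSet f L r s | p.1 ≤ r * α / s ∧ p.2 ≤ r * f α / s⁻¹} := by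
    rw [Set.disjoint_left]
    rintro p hp ⟨_, h1, h2⟩
    rcases hp with hp | hp
    · exact absurd hp.2 (not_lt.2 h1)
    · exact absurd hp.2 (not_lt.2 h2)
  change (latticeSet f L r s).ncard = _
  conv_lhs => rw [hunion]
  rw [Set.ncard_union_eq hdis (finA.union finB) (fin.subset (sep_subset _ _)),
    Set.ncard_union_eq hAB finA finB, ← hC, Set.ncard_coe_finset, Finset.card_product]
  simp

lemma curveArea_eq (h : IsConvexDecreasingCurve f L M) : curveArea f L = ∫ x in (0 : ℝ)..L, f x := by
  have hi : IntegrableOn f (Ioo 0 L) :=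
    (h.continuous.integrableOn_Icc).mono_set Ioo_subset_Icc_self
  unfold curveArea
  rw [Measure.real, Measure.volume_eq_prod, volume_regionBetween_eq_integral (f := fun _ => 0)
    (integrable_zero _ _ _) hi measurableSet_Ioo
    (fun x hx => (h.map_mem (Ioo_subset_Icc_self hx)).1), ENNReal.toReal_ofReal]
  · rw [intervalIntegral.integral_of_le h.L_pos.le, integral_Ioc_eq_integral_Ioo]
    simp
  · refine setIntegral_nonneg measurableSet_Ioo fun x hx => ?_
    simpa using (h.map_mem (Ioo_subset_Icc_self hx)).1

lemma intervalIntegrable (h : IsConvexDecreasingCurve f L M) {a b : ℝ} (ha : a ∈ Icc 0 L)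
    (hb : b ∈ Icc 0 L) : IntervalIntegrable f volume a b :=
  (h.continuous.mono (uIcc_subset_Icc ha hb)).intervalIntegrable

/-- The two regions are reflections of each other in the diagonal, and the reflection preserves
area. -/
lemma integral_sub_eq_integral_inverse (h : IsConvexDecreasingCurve f L M) {α : ℝ}
    (hα : α ∈ Icc 0 L) :
    ∫ x in (0 : ℝ)..α, (f x - f α) = ∫ y in (f α)..M, curveInverse f L y := by
  have hβ := h.map_mem hα
  have hsub : Ioo 0 α ⊆ Icc 0 L := fun x hx => ⟨hx.1.le, hx.2.le.trans hα.2⟩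
  have hsub' : Ioo (f α) M ⊆ Icc 0 M := fun x hx => ⟨hβ.1.trans hx.1.le, hx.2.le⟩
  have i1 : IntegrableOn f (Ioo 0 α) := h.continuous.integrableOn_Icc.mono_set hsub
  have i2 : IntegrableOn (curveInverse f L) (Ioo (f α) M) :=
    h.inverse.continuous.integrableOn_Icc.mono_set hsub'
  have ic : IntegrableOn (fun _ : ℝ => f α) (Ioo 0 α) := by simp
  have le1 : ∀ x ∈ Ioo 0 α, f α ≤ f x := fun x hx =>
    h.strictAnti.antitoneOn (hsub hx) hα hx.2.le
  have le2 : ∀ y ∈ Ioo (f α) M, 0 ≤ curveInverse f L y := fun y hy =>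
    (h.inverse_mem (hsub' hy)).1
  have v1 := volume_regionBetween_eq_integral ic i1 measurableSet_Ioo le1
  have v2 := volume_regionBetween_eq_integral (f := fun _ => 0) (integrable_zero _ _ _) i2
    measurableSet_Ioo le2
  have hswap : regionBetween (fun _ => f α) f (Ioo 0 α) =
      Prod.swap ⁻¹' regionBetween (fun _ => 0) (curveInverse f L) (Ioo (f α) M) := by
    ext ⟨x, y⟩
    simp only [regionBetween, mem_preimage, mem_ofPred_eq, Prod.swap, mem_Ioo]
    constructor
    · rintro ⟨⟨h1, h2⟩, h3, h4⟩
      have hx := hsub ⟨h1, h2⟩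
      have hy : y < M := h4.trans_le (h.map_mem hx).2
      exact ⟨⟨h3, hy⟩, h1, (h.lt_apply_iff hx (hsub' ⟨h3, hy⟩)).1 h4⟩
    · rintro ⟨⟨h1, h2⟩, h3, h4⟩
      have hy := hsub' ⟨h1, h2⟩
      have hx : x ∈ Icc 0 L := ⟨h3.le, h4.le.trans (h.inverse_mem hy).2⟩
      have h5 := (h.lt_apply_iff hx hy).2 h4
      exact ⟨⟨h3, (h.strictAnti.lt_iff_gt hα hx).1 (h1.trans h5)⟩, h1, h5⟩
  have hmp : (volume : Measure ℝ).prod (volume : Measure ℝ)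
      (Prod.swap ⁻¹' regionBetween (fun _ => 0) (curveInverse f L) (Ioo (f α) M)) =
      (volume : Measure ℝ).prod (volume : Measure ℝ)
        (regionBetween (fun _ => 0) (curveInverse f L) (Ioo (f α) M)) := by
    exact Measure.measurePreserving_swap.measure_preimage_equiv
      (f := MeasurableEquiv.prodComm) _
  rw [hswap, hmp, v2] at v1
  have n1 : 0 ≤ ∫ x in Ioo (0 : ℝ) α, (f - fun _ => f α : ℝ → ℝ) x :=
    setIntegral_nonneg measurableSet_Ioo fun x hx => sub_nonneg.2 (le1 x hx)
  have n2 : 0 ≤ ∫ y in Ioo (f α) M, (curveInverse f L - fun _ => 0 : ℝ → ℝ) y :=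
    setIntegral_nonneg measurableSet_Ioo fun x hx => by simpa using le2 x hx
  rw [ENNReal.ofReal_eq_ofReal_iff n2 n1] at v1
  rw [intervalIntegral.integral_of_le hα.1, intervalIntegral.integral_of_le hβ.2,
    integral_Ioc_eq_integral_Ioo, integral_Ioc_eq_integral_Ioo]
  simpa using v1.symm

lemma curveArea_split (h : IsConvexDecreasingCurve f L M) {α : ℝ} (hα : α ∈ Icc 0 L) :
    curveArea f L = (∫ x in α..L, f x) + (∫ y in (f α)..M, curveInverse f L y) + α * f α := by
  have h0 : (0 : ℝ) ∈ Icc 0 L := left_mem_Icc.2 h.L_pos.le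
  have hL : L ∈ Icc 0 L := right_mem_Icc.2 h.L_pos.le
  rw [← h.integral_sub_eq_integral_inverse hα, intervalIntegral.integral_sub
    (h.intervalIntegrable h0 hα) intervalIntegrable_const, intervalIntegral.integral_const,
    h.curveArea_eq, ← intervalIntegral.integral_add_adjacent_intervals
    (h.intervalIntegrable h0 hα) (h.intervalIntegrable hα hL)]
  simp
  ring

end IsConvexDecreasingCurve

/-! ### Comparing the count with the area; existence of maximizers. -/

lemma integral_affine (a b c k : ℝ) :
    ∫ x in a..b, (c + k * (x - a)) = (b - a) * c + k * (b - a) ^ 2 / 2 := by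
  have hi : ∀ g : ℝ → ℝ, Continuous g → IntervalIntegrable g volume a b :=
    fun g hg => hg.intervalIntegrable _ _
  rw [intervalIntegral.integral_add (hi _ (by fun_prop)) (hi _ (by fun_prop)),
    intervalIntegral.integral_const_mul,
    intervalIntegral.integral_sub (hi _ (by fun_prop)) (hi _ (by fun_prop))]
  simp
  ring

lemma affine_le_integral {f : ℝ → ℝ} {a b c k : ℝ} (hab : a ≤ b)
    (hf : IntervalIntegrable f volume a b) (h : ∀ x ∈ Icc a b, c + k * (x - a) ≤ f x) :
    (b - a) * c + k * (b - a) ^ 2 / 2 ≤ ∫ x in a..b, f x := by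
  rw [← integral_affine]
  exact intervalIntegral.integral_mono_on hab (Continuous.intervalIntegrable (by fun_prop) _ _) hf h

lemma integral_le_affine {f : ℝ → ℝ} {a b c k : ℝ} (hab : a ≤ b)
    (hf : IntervalIntegrable f volume a b) (h : ∀ x ∈ Icc a b, f x ≤ c + k * (x - a)) :
    ∫ x in a..b, f x ≤ (b - a) * c + k * (b - a) ^ 2 / 2 := by
  rw [← integral_affine]
  exact intervalIntegral.integral_mono_on hab hf (Continuous.intervalIntegrable (by fun_prop) _ _) h

lemma sum_Ioc_eq_sum_range {R : Type*} [AddCommMonoid R] (g : ℕ → R) (a b : ℕ) :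
    ∑ j ∈ Finset.Ioc a b, g j = ∑ i ∈ Finset.range (b - a), g (a + 1 + i) := by
  have : Finset.Ioc a b = Finset.Ico (a + 1) (b + 1) := by
    ext; simp only [Finset.mem_Ioc, Finset.mem_Ico]; omega
  rw [this, Finset.sum_Ico_eq_sum_range, Nat.add_sub_add_right]

namespace IsConvexDecreasingCurve

variable {f : ℝ → ℝ} {L M : ℝ}

lemma nonneg (h : IsConvexDecreasingCurve f L M) {x : ℝ} (hx : x ∈ Icc 0 L) : 0 ≤ f x :=
  (h.map_mem hx).1

lemma integral_nonneg (h : IsConvexDecreasingCurve f L M) {a b : ℝ} (ha : 0 ≤ a) (hab : a ≤ b)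
    (hb : b ≤ L) : 0 ≤ ∫ x in a..b, f x :=
  intervalIntegral.integral_nonneg hab fun _ hx => h.nonneg ⟨ha.trans hx.1, hx.2.trans hb⟩

lemma mul_le_integral (h : IsConvexDecreasingCurve f L M) {a b : ℝ} (ha : 0 ≤ a) (hab : a ≤ b)
    (hb : b ≤ L) : (b - a) * f b ≤ ∫ x in a..b, f x := by
  have := affine_le_integral (c := f b) (k := 0) hab
    (h.intervalIntegrable ⟨ha, hab.trans hb⟩ ⟨ha.trans hab, hb⟩) (fun x hx => by
      have := h.strictAnti.antitoneOn ⟨ha.trans hx.1, hx.2.trans hb⟩ ⟨ha.trans hab, hb⟩ hx.2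
      simpa using this)
  simpa using this

/-- By convexity every chord over `[0, L / 2]` is at least as steep as the chord from `L / 2` to
`L`. -/
lemma steep (h : IsConvexDecreasingCurve f L M) {x y : ℝ} (hx : 0 ≤ x) (hxy : x ≤ y)
    (hy : y ≤ L / 2) : f y + f (L / 2) / (L / 2) * (y - x) ≤ f x := by
  have hL := h.L_pos
  have base : ∀ z, 0 ≤ z → z < L / 2 →
      (f (L / 2) - f z) / (L / 2 - z) ≤ -(f (L / 2) / (L / 2)) := by
    intro z hz hz'
    have := h.convex.slope_mono_adjacent (x := z) (y := L / 2) (z := L) ⟨hz, by linarith⟩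
      ⟨hL.le, le_rfl⟩ hz' (by linarith)
    rw [h.map_L] at this
    refine this.trans (le_of_eq ?_)
    rw [show L - L / 2 = L / 2 by ring]
    ring
  have key : x < y → (f y - f x) / (y - x) ≤ -(f (L / 2) / (L / 2)) := by
    intro hlt
    rcases hy.eq_or_lt with rfl | hy'
    · exact base x hx hlt
    · exact (h.convex.slope_mono_adjacent (x := x) (y := y) (z := L / 2) ⟨hx, by linarith⟩
        ⟨by linarith, by linarith⟩ hlt hy').trans (base y (hx.trans hxy) hy')
  rcases hxy.eq_or_lt with rfl | hlt
  · simp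
  · have := key hlt
    rw [div_le_iff₀ (by linarith)] at this
    linarith

/-- The last summand on the left is the area of the triangle that fits between the inscribed
rectangle and the curve. -/
lemma steep_integral (h : IsConvexDecreasingCurve f L M) {a b : ℝ} (ha : 0 ≤ a) (hab : a ≤ b)
    (hb : b ≤ L / 2) :
    (b - a) * f b + f (L / 2) / (L / 2) * (b - a) ^ 2 / 2 ≤ ∫ x in a..b, f x := by
  have hL := h.L_pos
  have := affine_le_integral (c := f b + f (L / 2) / (L / 2) * (b - a))
    (k := - (f (L / 2) / (L / 2))) hab
    (h.intervalIntegrable ⟨ha, by linarith⟩ ⟨ha.trans hab, by linarith⟩) (fun x hx => by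
      have := h.steep (ha.trans hx.1) hx.2 hb
      linarith)
  refine le_trans (le_of_eq ?_) this
  ring

/-- An upper bound for the lattice count that beats the area by a boundary term. -/
lemma latticeCount_le (h : IsConvexDecreasingCurve f L M) {r s : ℝ} (hr : 0 < r) (hs : 0 < s) :
    (latticeCount f L r s : ℝ) ≤
      r ^ 2 * (curveArea f L - f (L / 2) / 4 * min (s / r) L) := by
  have hL := h.L_pos
  have hf2 : 0 ≤ f (L / 2) := h.nonneg ⟨by linarith, by linarith⟩
  set u := s / r with hu
  have hu0 : 0 < u := by positivity
  have hs' : s = r * u := by rw [hu]; field_simp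
  set n := ⌊r * L / s⌋₊ with hn
  have hn' : (n : ℝ) * u ≤ L := by
    have := Nat.floor_le (by positivity : 0 ≤ r * L / s)
    rw [le_div_iff₀ hs] at this
    rw [hu, ← mul_div_assoc, div_le_iff₀ hr]
    linarith
  have hmem : ∀ i < n, ((i : ℝ) + 1) * u ≤ L := by
    intro i hi
    refine le_trans ?_ hn'
    gcongr
    exact_mod_cast hi
  have h1 : (latticeCount f L r s : ℝ) ≤
      r ^ 2 * ∑ i ∈ Finset.range n, u * f ((i + 1) * u) := by
    rw [latticeCount_eq_sum f L hr hs, ← hn, Finset.mul_sum]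
    push_cast
    rw [sum_Ioc_eq_sum_range, Nat.sub_zero]
    refine Finset.sum_le_sum fun i hi => ?_
    have e : ((0 + 1 + i : ℕ) : ℝ) * s / r = (i + 1) * u := by
      rw [hu]; push_cast; ring
    rw [e]
    have hf0 : 0 ≤ f ((i + 1) * u) := h.nonneg ⟨by positivity, hmem i (Finset.mem_range.1 hi)⟩
    refine (Nat.floor_le (by positivity)).trans (le_of_eq ?_)
    rw [hs']; ring
  refine h1.trans (mul_le_mul_of_nonneg_left ?_ (by positivity))
  rw [h.curveArea_eq]
  rcases le_or_gt u (L / 2) with hcase | hcase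
  -- There are `m ≥ L / (4u)` columns of width `u` inside the left half, and each wastes a triangle
  -- of area `f (L / 2) / (L / 2) * u² / 2`.
  · set m := ⌊L / (2 * u)⌋₊ with hm
    have hm' : (m : ℝ) * u ≤ L / 2 := by
      have := Nat.floor_le (by positivity : 0 ≤ L / (2 * u))
      rw [le_div_iff₀ (by positivity)] at this
      linarith
    have hm1 : L / (4 * u) ≤ m := by
      have h1 : 1 ≤ L / (2 * u) := by rw [le_div_iff₀ (by positivity)]; linarith
      have h2 := Nat.lt_floor_add_one (L / (2 * u))
      have h3 : (1 : ℝ) ≤ m := by exact_mod_cast (Nat.one_le_floor_iff _).2 h1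
      have e : L / (2 * u) = 2 * (L / (4 * u)) := by field_simp; ring
      rw [← hm, e] at h2
      linarith
    have hmn : m ≤ n := by
      refine Nat.floor_le_floor ?_
      rw [hs', div_le_div_iff₀ (by positivity) (by positivity)]
      have : 0 < L * r * u := by positivity
      nlinarith
    obtain ⟨q, hq⟩ := Nat.exists_eq_add_of_le hmn
    have hnL : (n : ℝ) * u ∈ Icc 0 L := ⟨by positivity, hn'⟩
    have hsplit : (∫ x in (0 : ℝ)..L, f x) = (∑ i ∈ Finset.range n,
        ∫ x in ((i : ℝ) * u)..(((i + 1 : ℕ) : ℝ) * u), f x) + ∫ x in ((n : ℝ) * u)..L, f x := by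
      rw [intervalIntegral.sum_integral_adjacent_intervals (a := fun i : ℕ => (i : ℝ) * u)]
      · rw [Nat.cast_zero, zero_mul, intervalIntegral.integral_add_adjacent_intervals
          (h.intervalIntegrable ⟨le_rfl, hL.le⟩ hnL) (h.intervalIntegrable hnL ⟨hL.le, le_rfl⟩)]
      · intro i hi
        have := hmem i hi
        refine h.intervalIntegrable ⟨by positivity, ?_⟩ ⟨by positivity, ?_⟩
        · nlinarith
        · push_cast; exact this
    have hrest := h.integral_nonneg hnL.1 hn' le_rfl
    have hlow : ∑ i ∈ Finset.range n, u * f ((i + 1) * u) +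
        m * (f (L / 2) / (L / 2) * u ^ 2 / 2) ≤ ∑ i ∈ Finset.range n,
        ∫ x in ((i : ℝ) * u)..(((i + 1 : ℕ) : ℝ) * u), f x := by
      rw [hq, Finset.sum_range_add, Finset.sum_range_add]
      have e1 : (m : ℝ) * (f (L / 2) / (L / 2) * u ^ 2 / 2) =
          ∑ i ∈ Finset.range m, f (L / 2) / (L / 2) * u ^ 2 / 2 := by simp
      rw [e1, add_right_comm, ← Finset.sum_add_distrib]
      refine add_le_add (Finset.sum_le_sum fun i hi => ?_) (Finset.sum_le_sum fun i hi => ?_)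
      · have hi' : ((i : ℝ) + 1) ≤ m := by exact_mod_cast Finset.mem_range.1 hi
        have := h.steep_integral (a := i * u) (b := ((i + 1 : ℕ) : ℝ) * u) (by positivity)
          (by push_cast; nlinarith) (by push_cast; nlinarith)
        push_cast at this ⊢
        rwa [show ((i : ℝ) + 1) * u - i * u = u by ring] at this
      · have hi' := hmem (m + i) (by have := Finset.mem_range.1 hi; omega)
        have := h.mul_le_integral (a := (m + i : ℕ) * u) (b := ((m + i + 1 : ℕ) : ℝ) * u)
          (by positivity) (by push_cast; nlinarith) (by push_cast at hi' ⊢; exact hi')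
        push_cast at this ⊢
        rwa [show ((m : ℝ) + i + 1) * u - (m + i) * u = u by ring] at this
    have hgain : f (L / 2) / 4 * u ≤ m * (f (L / 2) / (L / 2) * u ^ 2 / 2) := by
      calc f (L / 2) / 4 * u = L / (4 * u) * (f (L / 2) / (L / 2) * u ^ 2 / 2) := by
            field_simp
        _ ≤ _ := by gcongr
    rw [min_eq_left (by linarith)]
    linarith
  -- Here `2u > L`, so there is at most one column; the loss is the single triangle over `[0, L /
  -- 2]`.
  · have e : (∫ x in (0 : ℝ)..L, f x) = (∫ x in (0 : ℝ)..(L / 2), f x) + ∫ x in (L / 2)..L, f x :=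
      (intervalIntegral.integral_add_adjacent_intervals (h.intervalIntegrable ⟨le_rfl, hL.le⟩
        ⟨by linarith, by linarith⟩) (h.intervalIntegrable ⟨by linarith, by linarith⟩
        ⟨hL.le, le_rfl⟩)).symm
    have i1 := h.steep_integral (a := 0) (b := L / 2) le_rfl (by linarith) le_rfl
    have i2 := h.integral_nonneg (a := L / 2) (b := L) (by linarith) (by linarith) le_rfl
    have hgain : f (L / 2) / (L / 2) * (L / 2 - 0) ^ 2 / 2 = f (L / 2) / 4 * L := by
      field_simp
      ring
    have hmin : f (L / 2) / 4 * min u L ≤ f (L / 2) / 4 * L := by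
      gcongr
      exact min_le_right _ _
    have hsum : ∑ i ∈ Finset.range n, u * f ((i + 1) * u) ≤
        (L / 2 - 0) * f (L / 2) + ∫ x in (L / 2)..L, f x := by
      have hp : 0 ≤ (L / 2 - 0) * f (L / 2) := mul_nonneg (by linarith) hf2
      rcases n with _ | n
      · simp only [Finset.range_zero, Finset.sum_empty]
        linarith
      have hu1 := hmem 0 (by omega)
      simp only [Nat.cast_zero, zero_add, one_mul] at hu1
      have j1 := h.mul_le_integral (a := L / 2) (by linarith) hcase.le hu1
      have j2 := h.integral_nonneg hu0.le hu1 le_rfl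
      have j3 := intervalIntegral.integral_add_adjacent_intervals
        (h.intervalIntegrable (a := L / 2) ⟨by linarith, by linarith⟩ ⟨hu0.le, hu1⟩)
        (h.intervalIntegrable ⟨hu0.le, hu1⟩ ⟨hL.le, le_rfl⟩)
      have j4 := h.strictAnti.antitoneOn ⟨by linarith, by linarith⟩ ⟨hu0.le, hu1⟩ hcase.le
      rcases n with _ | n
      · simp only [zero_add, Finset.sum_range_one, Nat.cast_zero, one_mul]
        nlinarith
      · have hu2 := hmem 1 (by omega)
        push_cast at hu2
        linarith
    linarith

/-- The counts are natural numbers bounded by `r² Area`, so their supremum is attained. -/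
lemma isGreatest_latticeCount (h : IsConvexDecreasingCurve f L M) {r : ℝ} (hr : 0 < r) :
    (optimalStretch f L r).Nonempty ∧
      IsGreatest (latticeCount f L r '' Ioi 0) (maxLatticeCount f L r) := by
  have hL := h.L_pos
  have hbdd : BddAbove (latticeCount f L r '' Ioi 0) := by
    refine ⟨⌊r ^ 2 * curveArea f L⌋₊, ?_⟩
    rintro _ ⟨s, hs, rfl⟩
    refine Nat.le_floor ((h.latticeCount_le hr hs).trans ?_)
    have hf2 : 0 ≤ f (L / 2) := h.nonneg ⟨by linarith, by linarith⟩
    have : 0 ≤ min (s / r) L := le_min (div_nonneg (le_of_lt hs) hr.le) hL.le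
    have : 0 ≤ f (L / 2) / 4 * min (s / r) L := by positivity
    gcongr
    linarith
  have hne : (latticeCount f L r '' Ioi 0).Nonempty := ⟨_, 1, mem_Ioi.2 one_pos, rfl⟩
  have hg : IsGreatest (latticeCount f L r '' Ioi 0) (maxLatticeCount f L r) :=
    ⟨Nat.sSup_mem hne hbdd, fun _ ha => le_csSup hbdd ha⟩
  refine ⟨?_, hg⟩
  obtain ⟨s, hs, he⟩ := hg.1
  exact ⟨s, hs, fun t ht => he ▸ hg.2 ⟨t, ht, rfl⟩⟩

end IsConvexDecreasingCurve

/-! ### Euler–Maclaurin summation for convex functions. -/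

lemma integral_le_trapezoid {F : ℝ → ℝ} {p : ℝ} (hF : ConvexOn ℝ (Icc p (p + 1)) F)
    (hc : ContinuousOn F (Icc p (p + 1))) :
    ∫ x in p..(p + 1), F x ≤ (F p + F (p + 1)) / 2 := by
  have h := integral_le_affine (f := F) (a := p) (b := p + 1) (c := F p) (k := F (p + 1) - F p)
    (by linarith) ((hc.mono (by rw [uIcc_of_le (by linarith)])).intervalIntegrable) (fun x hx => by
      have := hF.2 (left_mem_Icc.2 (by linarith)) (right_mem_Icc.2 (by linarith))
        (show 0 ≤ 1 - (x - p) by linarith [hx.2]) (show 0 ≤ x - p by linarith [hx.1]) (by ring)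
      simp only [smul_eq_mul] at this
      rw [show (1 - (x - p)) * p + (x - p) * (p + 1) = x by ring] at this
      linarith)
  refine h.trans (le_of_eq ?_)
  ring

/-- On each unit interval the trapezoid exceeds the integral by at most half the difference between
its chord slope and the preceding one; these telescope, with `-Λ` in place of the slope before the
first interval. -/
lemma trapezoid_error {F : ℝ → ℝ} {c Λ : ℝ} (K : ℕ)
    (hF : ConvexOn ℝ (Icc c (c + (K + 1 : ℕ))) F) (hc : ContinuousOn F (Icc c (c + (K + 1 : ℕ))))
    (hlip : ∀ x ∈ Icc c (c + (K + 1 : ℕ)), F c - Λ * (x - c) ≤ F x) :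
    (∫ x in c..(c + (K + 1 : ℕ)), F x) ≤
      ∑ i ∈ Finset.range (K + 1), (F (c + i) + F (c + (i + 1 : ℕ))) / 2 ∧
    ∑ i ∈ Finset.range (K + 1), (F (c + i) + F (c + (i + 1 : ℕ))) / 2 ≤
      (∫ x in c..(c + (K + 1 : ℕ)), F x) + (F (c + (K + 1 : ℕ)) - F (c + K) + Λ) / 2 := by
  induction K with
  | zero =>
    simp only [zero_add, Nat.cast_one, Finset.sum_range_one, Nat.cast_zero, add_zero] at *
    refine ⟨integral_le_trapezoid hF hc, ?_⟩
    have := affine_le_integral (f := F) (a := c) (b := c + 1) (c := F c) (k := -Λ)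
      (by linarith) ((hc.mono (by rw [uIcc_of_le (by linarith)])).intervalIntegrable)
      (fun x hx => by have := hlip x hx; linarith)
    simp only [add_sub_cancel_left] at this
    linarith
  | succ K ih =>
    have hK : (0 : ℝ) ≤ K := Nat.cast_nonneg K
    have e1 : c + ((K + 1 + 1 : ℕ) : ℝ) = c + (K + 1 : ℕ) + 1 := by push_cast; ring
    have hsub : Icc c (c + (K + 1 : ℕ)) ⊆ Icc c (c + (K + 1 + 1 : ℕ)) :=
      Icc_subset_Icc le_rfl (by push_cast; linarith)
    have hsub' : Icc (c + (K + 1 : ℕ)) (c + (K + 1 : ℕ) + 1) ⊆ Icc c (c + (K + 1 + 1 : ℕ)) :=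
      Icc_subset_Icc (by push_cast; linarith) (by rw [e1])
    have ih := ih (hF.subset hsub (convex_Icc _ _)) (hc.mono hsub) (fun x hx => hlip x (hsub hx))
    have htr := integral_le_trapezoid (hF.subset hsub' (convex_Icc _ _)) (hc.mono hsub')
    have i1 : IntervalIntegrable F volume c (c + (K + 1 : ℕ)) :=
      (hc.mono (by rw [uIcc_of_le (by push_cast; linarith)]; exact hsub)).intervalIntegrable
    have i2 : IntervalIntegrable F volume (c + (K + 1 : ℕ)) (c + (K + 1 : ℕ) + 1) :=
      (hc.mono (by rw [uIcc_of_le (by linarith)]; exact hsub')).intervalIntegrable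
    have hlow := affine_le_integral (f := F) (c := F (c + (K + 1 : ℕ)))
      (k := F (c + (K + 1 : ℕ)) - F (c + K)) (by linarith) i2 (fun x hx => by
        rcases hx.1.eq_or_lt with h | h
        · rw [← h]; simp
        · have := hF.slope_mono_adjacent (x := c + K) (y := c + (K + 1 : ℕ)) (z := x)
            ⟨by linarith, by push_cast; linarith⟩ (hsub' hx) (by push_cast; linarith) h
          rw [show c + ((K + 1 : ℕ) : ℝ) - (c + K) = 1 by push_cast; ring, div_one,
            le_div_iff₀ (by linarith)] at this
          linarith)
    simp only [add_sub_cancel_left] at hlow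
    rw [Finset.sum_range_succ, e1, ← intervalIntegral.integral_add_adjacent_intervals i1 i2]
    constructor
    · linarith [ih.1]
    · linarith [ih.2]

/-- Euler–Maclaurin summation for a convex decreasing Lipschitz function. -/
lemma abs_sum_sub_integral_le {F : ℝ → ℝ} {a b Λ : ℝ} (ha : 0 ≤ a) (hab : a ≤ b)
    (hΛ : 0 ≤ Λ) (hF : ConvexOn ℝ (Icc a b) F) (hc : ContinuousOn F (Icc a b))
    (hanti : AntitoneOn F (Icc a b))
    (hlip : ∀ x ∈ Icc a b, ∀ y ∈ Icc a b, x ≤ y → F x - Λ * (y - x) ≤ F y) (hb : F b = 0) :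
    |∑ j ∈ Finset.Ioc ⌊a⌋₊ ⌊b⌋₊, F j - ((∫ x in a..b, F x) + saw a * F a)| ≤ 4 * Λ := by
  have fa := Nat.floor_le ha
  have fa' := Nat.lt_floor_add_one a
  have fb := Nat.floor_le (ha.trans hab)
  have fb' := Nat.lt_floor_add_one b
  have mono := Nat.floor_le_floor hab
  have hfr : saw a = a - ⌊a⌋₊ - 1 / 2 := by
    rw [saw, Int.fract, natCast_floor_eq_intCast_floor ha]
  have amem : a ∈ Icc a b := left_mem_Icc.2 hab
  have bmem : b ∈ Icc a b := right_mem_Icc.2 hab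
  have nn : ∀ x ∈ Icc a b, 0 ≤ F x := fun x hx => hb ▸ hanti hx bmem hx.2
  have ii : ∀ x ∈ Icc a b, ∀ y ∈ Icc a b, IntervalIntegrable F volume x y := fun x hx y hy =>
    (hc.mono (uIcc_subset_Icc hx hy)).intervalIntegrable
  have lowint : ∀ x ∈ Icc a b, ∀ y ∈ Icc a b, x ≤ y → y ≤ x + 1 →
      (∫ z in x..y, F z) ≤ (y - x) * F x ∧ (y - x) * F x - Λ ≤ ∫ z in x..y, F z := by
    intro x hx y hy hxy hxy1
    constructor
    · have := integral_le_affine (c := F x) (k := 0) hxy (ii x hx y hy) (fun z hz => by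
        have := hanti hx ⟨hx.1.trans hz.1, hz.2.trans hy.2⟩ hz.1
        linarith)
      linarith
    · have := affine_le_integral (c := F x) (k := -Λ) hxy (ii x hx y hy) (fun z hz => by
        have := hlip x hx z ⟨hx.1.trans hz.1, hz.2.trans hy.2⟩ hz.1
        linarith)
      have h2 : (y - x) ^ 2 ≤ 1 := by nlinarith
      have : Λ * (y - x) ^ 2 ≤ Λ := by nlinarith
      linarith
  -- If there is no integer in `(a, b]`, then `F` falls to zero within length one, so every quantity
  -- is at most `Λ`.
  rcases mono.eq_or_lt with h | h
  · have hb1 : b ≤ a + 1 := by rw [← h] at fb'; linarith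
    have h1 := lowint a amem b bmem hab hb1
    have h2 := hlip a amem b bmem hab
    have h3 := nn a amem
    have h4 : F a ≤ Λ := by nlinarith
    have h5 : (b - a) * F a ≤ Λ := by nlinarith
    have h5' : 0 ≤ (b - a) * F a := mul_nonneg (by linarith) h3
    have h6 : |saw a * F a| ≤ Λ := by
      rw [abs_mul, abs_of_nonneg h3]
      nlinarith [abs_saw_le a, abs_nonneg (saw a)]
    have h7 := abs_le.1 h6
    rw [h, Finset.Ioc_self, Finset.sum_empty, abs_le]
    constructor <;> linarith [h1.1, h1.2]
  · obtain ⟨K, hK⟩ := Nat.exists_eq_add_of_lt h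
    set c : ℝ := ((⌊a⌋₊ + 1 : ℕ) : ℝ) with hcdef
    have hc' : c = ⌊a⌋₊ + 1 := by rw [hcdef]; push_cast; rfl
    have hbK : (⌊b⌋₊ : ℝ) = c + K := by rw [hK, hc']; push_cast; ring
    have cmem : c ∈ Icc a b := ⟨by linarith, by have := Nat.cast_nonneg (α := ℝ) K; linarith⟩
    have dmem : c + K ∈ Icc a b := ⟨by have := Nat.cast_nonneg (α := ℝ) K; linarith [cmem.1], by linarith⟩
    have hsum : ∑ j ∈ Finset.Ioc ⌊a⌋₊ ⌊b⌋₊, F j = ∑ i ∈ Finset.range (K + 1), F (c + i) := by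
      rw [sum_Ioc_eq_sum_range, show ⌊b⌋₊ - ⌊a⌋₊ = K + 1 by omega]
      exact Finset.sum_congr rfl fun i _ => by rw [hcdef]; push_cast; rfl
    have hsub : Icc c (c + K) ⊆ Icc a b := Icc_subset_Icc cmem.1 dmem.2
    have htrap : (∫ x in c..(c + K), F x) ≤ ∑ i ∈ Finset.range (K + 1), F (c + i)
          - F c / 2 - F (c + K) / 2 ∧
        ∑ i ∈ Finset.range (K + 1), F (c + i) - F c / 2 - F (c + K) / 2 ≤
          (∫ x in c..(c + K), F x) + Λ / 2 := by
      rcases K with _ | K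
      · simp
        constructor <;> linarith
      · have htel : ∀ m : ℕ, ∑ i ∈ Finset.range m, (F (c + i) + F (c + (i + 1 : ℕ))) / 2 =
            ∑ i ∈ Finset.range (m + 1), F (c + i) - F c / 2 - F (c + m) / 2 := by
          intro m
          induction m with
          | zero => simp; ring
          | succ m ih =>
            rw [Finset.sum_range_succ, ih, Finset.sum_range_succ _ (m + 1)]
            ring
        have := trapezoid_error K (hF.subset hsub (convex_Icc _ _)) (hc.mono hsub)
          (fun x hx => hlip c cmem x (hsub hx) hx.1)
        rw [htel] at this
        refine ⟨this.1, this.2.trans ?_⟩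
        have hm : F (c + (K + 1 : ℕ)) ≤ F (c + K) :=
          hanti (hsub ⟨by linarith [Nat.cast_nonneg (α := ℝ) K], by push_cast; linarith⟩) dmem
            (by push_cast; linarith)
        linarith
    have h1 := lowint a amem c cmem cmem.1 (by linarith)
    have h2 := lowint (c + K) dmem b bmem dmem.2 (by linarith)
    have hs1 := intervalIntegral.integral_add_adjacent_intervals (ii a amem c cmem)
      (ii c cmem _ dmem)
    have hs2 := intervalIntegral.integral_add_adjacent_intervals (ii a amem _ dmem)
      (ii _ dmem b bmem)
    have hFc := hlip a amem c cmem cmem.1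
    have hFc' := hanti amem cmem cmem.1
    have hFd := hlip _ dmem b bmem dmem.2
    have hFd0 := nn _ dmem
    rw [hb] at hFd
    have h3 : Λ * (c - a) ≤ Λ := by nlinarith
    have h4 : Λ * (b - (c + K)) ≤ Λ := by nlinarith
    have h5 : (b - (c + K)) * F (c + K) ≤ Λ := by
      have : F (c + K) ≤ Λ := by linarith
      have : (b - (c + K)) * F (c + K) ≤ 1 * F (c + K) := by gcongr; linarith
      linarith
    have h5' : 0 ≤ ∫ z in (c + K)..b, F z :=
      intervalIntegral.integral_nonneg dmem.2 fun x hx => nn x ⟨dmem.1.trans hx.1, hx.2⟩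
    -- The boundary term is the half weight of the first node `c` minus the area over the incomplete
    -- interval `[a, c]`, with `F` frozen at `a`.
    have h6 : saw a * F a = F a / 2 - (c - a) * F a := by rw [hfr, hc']; ring
    rw [hsum, h6, abs_le]
    constructor <;> linarith [h1.1, h1.2, h2.1, h2.2, htrap.1, htrap.2]

/-- The floor sum of a convex decreasing Lipschitz function in terms of a sawtooth sum. -/
lemma abs_sum_floor_sub_le {F : ℝ → ℝ} {a b Λ : ℝ} (ha : 0 ≤ a) (hab : a ≤ b)
    (hΛ : 0 ≤ Λ) (hF : ConvexOn ℝ (Icc a b) F) (hc : ContinuousOn F (Icc a b))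
    (hanti : AntitoneOn F (Icc a b))
    (hlip : ∀ x ∈ Icc a b, ∀ y ∈ Icc a b, x ≤ y → F x - Λ * (y - x) ≤ F y) (hb : F b = 0) :
    |((∑ j ∈ Finset.Ioc ⌊a⌋₊ ⌊b⌋₊, ⌊F j⌋₊ : ℕ) : ℝ) -
      ((∫ x in a..b, F x) + saw a * F a - (b - a) / 2)| ≤
      |∑ j ∈ Finset.Ioc ⌊a⌋₊ ⌊b⌋₊, saw (F j)| + 4 * Λ + 1 / 2 := by
  have h := abs_sum_sub_integral_le ha hab hΛ hF hc hanti hlip hb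
  have hfa : saw a = a - ⌊a⌋₊ - 1 / 2 := by
    rw [saw, Int.fract, natCast_floor_eq_intCast_floor ha]
  have hfb : saw b = b - ⌊b⌋₊ - 1 / 2 := by
    rw [saw, Int.fract, natCast_floor_eq_intCast_floor (ha.trans hab)]
  have hfl : ((∑ j ∈ Finset.Ioc ⌊a⌋₊ ⌊b⌋₊, ⌊F j⌋₊ : ℕ) : ℝ) =
      ∑ j ∈ Finset.Ioc ⌊a⌋₊ ⌊b⌋₊, F j - ∑ j ∈ Finset.Ioc ⌊a⌋₊ ⌊b⌋₊, saw (F j)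
        - ((⌊b⌋₊ : ℝ) - ⌊a⌋₊) / 2 := by
    have e : ((⌊b⌋₊ : ℝ) - ⌊a⌋₊) / 2 = ∑ j ∈ Finset.Ioc ⌊a⌋₊ ⌊b⌋₊, (1 / 2 : ℝ) := by
      rw [Finset.sum_const, Nat.card_Ioc, nsmul_eq_mul, Nat.cast_sub (Nat.floor_le_floor hab)]
      ring
    rw [e, ← Finset.sum_sub_distrib, ← Finset.sum_sub_distrib]
    push_cast
    refine Finset.sum_congr rfl fun j hj => ?_
    rw [Finset.mem_Ioc] at hj
    have hj1 : a ≤ j := ((Nat.floor_lt ha).1 hj.1).le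
    have hj2 : (j : ℝ) ≤ b := (Nat.le_floor_iff (ha.trans hab)).1 hj.2
    have h0 : 0 ≤ F j := hb ▸ hanti ⟨hj1, hj2⟩ (right_mem_Icc.2 hab) hj2
    rw [saw, Int.fract, natCast_floor_eq_intCast_floor h0]
    ring
  have s1 := abs_le.1 (abs_saw_le a)
  have s2 := abs_le.1 (abs_saw_le b)
  have h' := abs_le.1 h
  have s3 := neg_abs_le (∑ j ∈ Finset.Ioc ⌊a⌋₊ ⌊b⌋₊, saw (F j))
  have s4 := le_abs_self (∑ j ∈ Finset.Ioc ⌊a⌋₊ ⌊b⌋₊, saw (F j))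
  rw [hfl, abs_le]
  constructor <;> linarith

/-! ### From second derivatives to second differences. -/

namespace IsRegularOn

variable {h : ℝ → ℝ} {a b : ℝ}

lemma hasDerivAt (hr : IsRegularOn h a b) {x : ℝ} (hx : x ∈ Ioo a b) :
    HasDerivAt h (derivWithin h (Ico a b) x) x := by
  have hn : Ico a b ∈ nhds x := Ico_mem_nhds hx.1 hx.2
  have h1 : DifferentiableOn ℝ h (Ico a b) := hr.contDiffOn.differentiableOn (by norm_num)
  exact ((h1 x (Ioo_subset_Ico_self hx)).hasDerivWithinAt).hasDerivAt hn

lemma hasDerivAt_derivWithin (hr : IsRegularOn h a b) {x : ℝ} (hx : x ∈ Ioo a b) :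
    HasDerivAt (derivWithin h (Ico a b)) (secondDeriv h a b x) x := by
  have hn : Ico a b ∈ nhds x := Ico_mem_nhds hx.1 hx.2
  have h1 := hr.contDiffOn.differentiableOn_iteratedDerivWithin (m := 1) (by norm_num)
    (uniqueDiffOn_Ico a b)
  have h2 := ((h1 x (Ioo_subset_Ico_self hx)).hasDerivWithinAt).hasDerivAt hn
  rw [← iteratedDerivWithin_succ] at h2
  rwa [iteratedDerivWithin_one] at h2

lemma continuousOn_secondDeriv (hr : IsRegularOn h a b) :
    ContinuousOn (secondDeriv h a b) (Ico a b) :=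
  hr.contDiffOn.continuousOn_iteratedDerivWithin (by norm_num) (uniqueDiffOn_Ico a b)

/-- The second derivative is bounded below by its value further to the right, up to a constant. -/
lemma exists_min_le (hr : IsRegularOn h a b) (hab : a < b) :
    ∃ c > 0, ∀ x y, a ≤ x → x ≤ y → y < b →
      min c (secondDeriv h a b y) ≤ secondDeriv h a b x := by
  have compact : ∀ z, a ≤ z → z < b → ∃ c > 0, ∀ x ∈ Icc a z, c ≤ secondDeriv h a b x := by
    intro z hz hzb
    have hsub : Icc a z ⊆ Ico a b := fun x hx => ⟨hx.1, hx.2.trans_lt hzb⟩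
    obtain ⟨x₀, hx₀, hmin⟩ := isCompact_Icc.exists_isMinOn (nonempty_Icc.2 hz)
      (hr.continuousOn_secondDeriv.mono hsub)
    exact ⟨_, hr.secondDeriv_pos x₀ (hsub hx₀), fun x hx => hmin hx⟩
  obtain ⟨m, p, hp, hp0, hpm, hmono⟩ := hr.piecewise
  rcases m with _ | k
  · rw [show Fin.last 0 = 0 from rfl, hp0] at hpm
    exact absurd hpm hab.ne
  have hlt : p (Fin.last k).castSucc < b := by
    rw [← hpm]; exact hp (Fin.castSucc_lt_last _)
  have hge : a ≤ p (Fin.last k).castSucc := by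
    rw [← hp0]; exact hp.monotone (Fin.zero_le _)
  have hl := hmono (Fin.last k)
  rw [Fin.succ_last, hpm] at hl
  set q := p (Fin.last k).castSucc
  -- Up to the midpoint of the last monotonicity interval, compactness gives a positive lower bound.
  -- Past it, the second derivative is at least its midpoint value if it increases, and at least its
  -- value at `y` if it decreases.
  obtain ⟨c, hc, hcz⟩ := compact ((q + b) / 2) (by linarith) (by linarith)
  refine ⟨c, hc, fun x y hx hxy hy => ?_⟩
  rcases le_or_gt x ((q + b) / 2) with hxz | hxz
  · exact (min_le_left _ _).trans (hcz x ⟨hx, hxz⟩)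
  · rcases hl with hl | hl
    · refine (min_le_left _ _).trans ((hcz ((q + b) / 2) ⟨by linarith, le_rfl⟩).trans ?_)
      exact hl ⟨by linarith, by linarith⟩ ⟨by linarith, by linarith⟩ hxz.le
    · exact (min_le_right _ _).trans (hl ⟨by linarith, by linarith⟩ ⟨by linarith, by linarith⟩ hxy)

end IsRegularOn

lemma second_difference_nonneg {k : ℝ → ℝ} {s : Set ℝ} (hk : ConvexOn ℝ s k) {x u : ℝ}
    (hx : x ∈ s) (hy : x + 2 * u ∈ s) : 0 ≤ k (x + 2 * u) - 2 * k (x + u) + k x := by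
  have := hk.2 hx hy (show (0 : ℝ) ≤ 1 / 2 by norm_num) (show (0 : ℝ) ≤ 1 / 2 by norm_num)
    (by norm_num)
  simp only [smul_eq_mul] at this
  rw [show 1 / 2 * x + 1 / 2 * (x + 2 * u) = x + u by ring] at this
  linarith

/-- Subtracting `c / 2 * z²` leaves a convex function, and the second difference of that quadratic
is `c * u²`. -/
lemma mul_sq_le_second_difference {h h₁ h₂ : ℝ → ℝ} {p q c x u : ℝ}
    (hd : ∀ x ∈ Ioo p q, HasDerivAt h (h₁ x) x) (hd' : ∀ x ∈ Ioo p q, HasDerivAt h₁ (h₂ x) x)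
    (hc : ∀ x ∈ Ioo p q, c ≤ h₂ x) (hx : x ∈ Ioo p q) (hy : x + 2 * u ∈ Ioo p q) :
    c * u ^ 2 ≤ h (x + 2 * u) - 2 * h (x + u) + h x := by
  have e1 : ∀ x ∈ Ioo p q, HasDerivAt (fun z => h z - c / 2 * z ^ 2) (h₁ x - c * x) x := by
    intro x hx
    have := (hd x hx).sub ((hasDerivAt_pow 2 x).const_mul (c / 2))
    convert! this using 1
    simp; ring
  have e2 : ∀ x ∈ Ioo p q, HasDerivAt (fun z => h₁ z - c * z) (h₂ x - c) x := by
    intro x hx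
    have := (hd' x hx).sub ((hasDerivAt_id x).const_mul c)
    convert! this using 1
    simp
  have hconv : ConvexOn ℝ (Ioo p q) (fun z => h z - c / 2 * z ^ 2) := by
    refine convexOn_of_hasDerivWithinAt2_nonneg (convex_Ioo p q)
      (f' := fun z => h₁ z - c * z) (f'' := fun z => h₂ z - c)
      (fun x hx => (e1 x hx).continuousAt.continuousWithinAt) ?_ ?_ ?_
    · intro x hx
      rw [interior_Ioo] at hx
      exact (e1 x hx).hasDerivWithinAt
    · intro x hx
      rw [interior_Ioo] at hx
      exact (e2 x hx).hasDerivWithinAt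
    · intro x hx
      rw [interior_Ioo] at hx
      have := hc x hx
      simpa using this
  have := second_difference_nonneg hconv hx hy
  nlinarith

/-- The derivative of a second difference of `h` is a second difference of `h₁`, which is convex
because its derivative `h₂` is monotone. -/
lemma second_difference_mono {h h₁ h₂ : ℝ → ℝ} {p q x y u : ℝ}
    (hd : ∀ x ∈ Ioo p q, HasDerivAt h (h₁ x) x) (hd' : ∀ x ∈ Ioo p q, HasDerivAt h₁ (h₂ x) x)
    (hmono : MonotoneOn h₂ (Ioo p q)) (hu : 0 ≤ u) (hx : p < x) (hxy : x ≤ y)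
    (hy : y + 2 * u < q) :
    h (x + 2 * u) - 2 * h (x + u) + h x ≤ h (y + 2 * u) - 2 * h (y + u) + h y := by
  have hconv : ConvexOn ℝ (Ioo p q) h₁ := by
    refine MonotoneOn.convexOn_of_deriv (convex_Ioo p q)
      (fun x hx => (hd' x hx).continuousAt.continuousWithinAt) ?_ ?_
    · rw [interior_Ioo]
      exact fun x hx => (hd' x hx).differentiableAt.differentiableWithinAt
    · rw [interior_Ioo]
      exact hmono.congr fun x hx => (hd' x hx).deriv.symm
  have hD : ∀ z ∈ Icc x y, HasDerivAt (fun z => h (z + 2 * u) - 2 * h (z + u) + h z)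
      (h₁ (z + 2 * u) - 2 * h₁ (z + u) + h₁ z) z := by
    intro z hz
    have m0 : z ∈ Ioo p q := ⟨by linarith [hz.1], by linarith [hz.2]⟩
    have m1 : z + u ∈ Ioo p q := ⟨by linarith [hz.1], by linarith [hz.2]⟩
    have m2 : z + 2 * u ∈ Ioo p q := ⟨by linarith [hz.1], by linarith [hz.2]⟩
    exact (((hd _ m2).comp_add_const z (2 * u)).sub
      (((hd _ m1).comp_add_const z u).const_mul 2)).add (hd z m0)
  have hm : MonotoneOn (fun z => h (z + 2 * u) - 2 * h (z + u) + h z) (Icc x y) := by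
    refine monotoneOn_of_hasDerivWithinAt_nonneg (convex_Icc x y)
      (f' := fun z => h₁ (z + 2 * u) - 2 * h₁ (z + u) + h₁ z)
      (fun z hz => (hD z hz).continuousAt.continuousWithinAt)
      (fun z hz => (hD z (interior_subset hz)).hasDerivWithinAt) (fun z hz => ?_)
    have hz := interior_subset hz
    exact second_difference_nonneg hconv ⟨by linarith [hz.1], by linarith [hz.2]⟩
      ⟨by linarith [hz.1], by linarith [hz.2]⟩
  exact hm (left_mem_Icc.2 hxy) (right_mem_Icc.2 hxy) hxy

lemma second_difference_anti {h h₁ h₂ : ℝ → ℝ} {p q x y u : ℝ}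
    (hd : ∀ x ∈ Ioo p q, HasDerivAt h (h₁ x) x) (hd' : ∀ x ∈ Ioo p q, HasDerivAt h₁ (h₂ x) x)
    (hanti : AntitoneOn h₂ (Ioo p q)) (hu : 0 ≤ u) (hx : p < x) (hxy : x ≤ y)
    (hy : y + 2 * u < q) :
    h (y + 2 * u) - 2 * h (y + u) + h y ≤ h (x + 2 * u) - 2 * h (x + u) + h x := by
  have := second_difference_mono (h := -h) (h₁ := -h₁) (h₂ := -h₂)
    (fun x hx => (hd x hx).neg) (fun x hx => (hd' x hx).neg) hanti.neg hu hx hxy hy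
  simp only [Pi.neg_apply] at this
  linarith

/-- Beyond `a > 0`, a convex decreasing curve is Lipschitz. -/
lemma IsConvexDecreasingCurve.lipschitz {h : ℝ → ℝ} {L M : ℝ} (hΓ : IsConvexDecreasingCurve h L M)
    {a x y : ℝ} (ha : 0 < a) (hx : a ≤ x) (hxy : x ≤ y) (hy : y ≤ L) :
    h x - (M - h a) / a * (y - x) ≤ h y := by
  have base : ∀ z, a < z → z ≤ L → -((M - h a) / a) ≤ (h z - h a) / (z - a) := by
    intro z hz hz'
    have := hΓ.convex.slope_mono_adjacent (x := 0) (y := a) (z := z) ⟨le_rfl, hΓ.L_pos.le⟩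
      ⟨by linarith, hz'⟩ ha hz
    rw [hΓ.map_zero, sub_zero] at this
    refine le_trans (le_of_eq ?_) this
    ring
  rcases hxy.eq_or_lt with rfl | hlt
  · simp
  have key : -((M - h a) / a) ≤ (h y - h x) / (y - x) := by
    rcases hx.eq_or_lt with rfl | hx'
    · exact base y hlt hy
    · exact (base x hx' (by linarith)).trans (hΓ.convex.slope_mono_adjacent (x := a) (y := x)
        (z := y) ⟨ha.le, by linarith⟩ ⟨by linarith, hy⟩ hx' hlt)
  rw [le_div_iff₀ (by linarith)] at key
  linarith

/-! ### Sawtooth sums along the curve. -/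

lemma abs_sum_saw_range_le (x : ℕ → ℝ) {m n : ℕ} (hmn : n ≤ m) :
    |∑ i ∈ Finset.range m, saw (x i)| ≤
      |∑ i ∈ Finset.range n, saw (x i)| + ((m : ℝ) - n) / 2 := by
  obtain ⟨k, rfl⟩ := Nat.exists_eq_add_of_le hmn
  rw [Finset.sum_range_add]
  refine (abs_add_le _ _).trans (add_le_add le_rfl ?_)
  refine (abs_sum_saw_le_card (fun i => x (n + i)) k).trans (le_of_eq ?_)
  push_cast
  ring

/-- The sawtooth estimate is used only up to `y`, where the lower bound `μ` on `h₂` holds; the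
points beyond `y` are counted trivially and give the last term. With spacing `t / r` the second
differences are at least `μ t³ / r`, and the first differences change by at most `(M - h a) / a *
t²` in total. -/
lemma abs_sum_saw_piece_le {h h₁ h₂ : ℝ → ℝ} {a b M p q y μ r t σ τ : ℝ}
    (hΓ : IsConvexDecreasingCurve h b M) (ha : 0 < a) (hp : a ≤ p) (hpq : p ≤ q) (hq : q ≤ b)
    (hy : a ≤ y) (hyb : y ≤ b)
    (hd : ∀ x ∈ Ioo a b, HasDerivAt h (h₁ x) x) (hd' : ∀ x ∈ Ioo a b, HasDerivAt h₁ (h₂ x) x)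
    (hmono : MonotoneOn h₂ (Ioo p q) ∨ AntitoneOn h₂ (Ioo p q))
    (hμ : ∀ x, a ≤ x → x < y → μ ≤ h₂ x) (hr : 0 < r) (ht : 0 < t) (hσ : 0 < σ) (hτ : 0 < τ)
    (hτ6 : τ ^ 6 ≤ μ * t ^ 3 / r) :
    |∑ j ∈ Finset.Ioc ⌊r * p / t⌋₊ ⌊r * q / t⌋₊, saw (r * t * h (j * t / r))| ≤
      121 * (r * b / t * σ + (M - h a) / a * t ^ 2 / σ ^ 2 + 2 / τ ^ 3) + 4
        + r * (b - y) / t := by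
  set u := t / r with hu
  have hu0 : 0 < u := by positivity
  set N₀ := ⌊r * p / t⌋₊ with hN₀
  set N₁ := ⌊r * q / t⌋₊ with hN₁
  set N₂ := min N₁ ⌊r * y / t⌋₊ with hN₂
  have hΛ : 0 ≤ (M - h a) / a :=
    div_nonneg (sub_nonneg.2 (hΓ.map_mem ⟨ha.le, by linarith⟩).2) ha.le
  have p0 : 0 ≤ r * p / t := div_nonneg (mul_nonneg hr.le (by linarith)) ht.le
  have y0 : 0 ≤ r * y / t := div_nonneg (mul_nonneg hr.le (by linarith)) ht.le
  have q0 : 0 ≤ r * q / t := div_nonneg (mul_nonneg hr.le (by linarith)) ht.le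
  have low : ∀ j : ℕ, N₀ < j → p < j * u := by
    intro j hj
    have := (Nat.floor_lt p0).1 hj
    rw [div_lt_iff₀ ht] at this
    rw [hu, ← mul_div_assoc, lt_div_iff₀ hr]
    linarith
  have up : ∀ j : ℕ, j ≤ N₂ → j * u ≤ q ∧ j * u ≤ y := by
    intro j hj
    have h1 := (Nat.le_floor_iff q0).1 (hj.trans (min_le_left _ _))
    have h2 := (Nat.le_floor_iff y0).1 (hj.trans (min_le_right _ _))
    rw [le_div_iff₀ ht] at h1 h2
    rw [hu, ← mul_div_assoc, div_le_iff₀ hr, div_le_iff₀ hr]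
    constructor <;> linarith
  have up' : ∀ j : ℕ, j < N₂ → j * u < q ∧ j * u < y := by
    intro j hj
    have := up (j + 1) hj
    push_cast at this
    constructor <;> nlinarith [this.1, this.2]
  set x : ℕ → ℝ := fun k => r * t * h ((N₀ + 1 + k : ℕ) * u) with hx
  have hsum : ∑ j ∈ Finset.Ioc N₀ N₁, saw (r * t * h (j * t / r)) =
      ∑ k ∈ Finset.range (N₁ - N₀), saw (x k) := by
    rw [sum_Ioc_eq_sum_range]
    refine Finset.sum_congr rfl fun k _ => ?_
    rw [hx, hu, mul_div_assoc]
  -- The offset keeps all three nodes of each second difference strictly below `q` and `y`;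
  -- truncated subtraction gives `n = 0` when there is no room.
  set n := N₂ - 3 - N₀ with hn
  have hnle : n ≤ N₁ - N₀ := by omega
  have hN21 : N₂ ≤ N₁ := min_le_left _ _
  have hsd : ∀ k, secondDiff x k = r * t * (h ((N₀ + 1 + k : ℕ) * u + 2 * u)
      - 2 * h ((N₀ + 1 + k : ℕ) * u + u) + h ((N₀ + 1 + k : ℕ) * u)) := by
    intro k
    simp only [secondDiff, hx]
    rw [show ((N₀ + 1 + (k + 2) : ℕ) : ℝ) * u = (N₀ + 1 + k : ℕ) * u + 2 * u by push_cast; ring,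
      show ((N₀ + 1 + (k + 1) : ℕ) : ℝ) * u = (N₀ + 1 + k : ℕ) * u + u by push_cast; ring]
    ring
  have hpt : ∀ k < n, p < (N₀ + 1 + k : ℕ) * u ∧ ((N₀ + 1 + k : ℕ) * u + 2 * u) < q ∧
      ((N₀ + 1 + k : ℕ) * u + 2 * u) < y := by
    intro k hk
    have h1 := low (N₀ + 1 + k) (by omega)
    have h2 := up' (N₀ + 1 + k + 2) (by omega)
    rw [show ((N₀ + 1 + k + 2 : ℕ) : ℝ) * u = (N₀ + 1 + k : ℕ) * u + 2 * u by push_cast; ring]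
      at h2
    exact ⟨h1, h2⟩
  have sub : Ioo p (min q y) ⊆ Ioo a b := fun z hz =>
    ⟨hp.trans_lt hz.1, (hz.2.trans_le (min_le_left _ _)).trans_le hq⟩
  have sub' : Ioo p q ⊆ Ioo a b := Ioo_subset_Ioo hp hq
  have main : |∑ k ∈ Finset.range n, saw (x k)| ≤
      121 * (n * σ + (M - h a) / a * t ^ 2 / σ ^ 2 + 2 / τ ^ 3) + 2 := by
    rcases Nat.eq_zero_or_pos n with hn0 | hn0
    · rw [hn0]
      simp
      positivity
    refine abs_sum_saw_le x hσ n hτ (fun k hk => ?_) ?_ ?_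
    · have h1 := hpt k hk
      have h2 := mul_sq_le_second_difference (c := μ) (u := u)
        (fun z hz => hd z (sub hz)) (fun z hz => hd' z (sub hz))
        (fun z hz => hμ z (hp.trans hz.1.le) (hz.2.trans_le (min_le_right _ _)))
        (x := (N₀ + 1 + k : ℕ) * u) ⟨h1.1, lt_min (by linarith) (by linarith)⟩
        ⟨by linarith, lt_min h1.2.1 h1.2.2⟩
      rw [hsd]
      refine hτ6.trans ?_
      calc μ * t ^ 3 / r = r * t * (μ * u ^ 2) := by rw [hu]; field_simp
        _ ≤ _ := by gcongr
    · have hstep : ∀ k, ((N₀ + 1 + k : ℕ) : ℝ) * u ≤ (N₀ + 1 + (k + 1) : ℕ) * u := by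
        intro k; gcongr; omega
      rcases hmono with hm | hm
      · left
        intro k hk
        rw [hsd, hsd]
        exact mul_le_mul_of_nonneg_left (second_difference_mono (fun z hz => hd z (sub' hz))
          (fun z hz => hd' z (sub' hz)) hm hu0.le (hpt k (by omega)).1 (hstep k)
          (hpt (k + 1) hk).2.1) (by positivity)
      · right
        intro k hk
        rw [hsd, hsd]
        exact mul_le_mul_of_nonneg_left (second_difference_anti (fun z hz => hd z (sub' hz))
          (fun z hz => hd' z (sub' hz)) hm hu0.le (hpt k (by omega)).1 (hstep k)
          (hpt (k + 1) hk).2.1) (by positivity)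
    · have l0 := low (N₀ + 1 + 0) (by omega)
      have ln := low (N₀ + 1 + n) (by omega)
      have u1 := up (N₀ + 1 + 1) (by omega)
      have un := up (N₀ + 1 + (n + 1)) (by omega)
      have h1 := hΓ.lipschitz ha (x := (N₀ + 1 + 0 : ℕ) * u) (y := (N₀ + 1 + 1 : ℕ) * u)
        (by linarith) (by gcongr; omega) (by linarith [u1.1])
      have h2 := hΓ.strictAnti.antitoneOn (a := (N₀ + 1 + n : ℕ) * u)
        (b := (N₀ + 1 + (n + 1) : ℕ) * u) ⟨by positivity, by
          have : ((N₀ + 1 + n : ℕ) : ℝ) * u ≤ (N₀ + 1 + (n + 1) : ℕ) * u := by gcongr; omega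
          linarith [un.1]⟩
        ⟨by positivity, by linarith [un.1]⟩ (by gcongr; omega)
      rw [show ((N₀ + 1 + 1 : ℕ) : ℝ) * u - (N₀ + 1 + 0 : ℕ) * u = u by push_cast; ring] at h1
      have h3 : r * t * h ((N₀ + 1 + (n + 1) : ℕ) * u) ≤ r * t * h ((N₀ + 1 + n : ℕ) * u) := by
        gcongr
      have h4 : r * t * (h ((N₀ + 1 + 0 : ℕ) * u) - (M - h a) / a * u) ≤
          r * t * h ((N₀ + 1 + 1 : ℕ) * u) := by gcongr
      have h5 : r * t * ((M - h a) / a * u) = (M - h a) / a * t ^ 2 := by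
        rw [hu]; field_simp
      simp only [hx]
      linarith
  have hn_le : (n : ℝ) ≤ r * b / t := by
    have h1 : n ≤ N₁ := by omega
    have h2 := Nat.floor_le q0
    have h3 : r * q / t ≤ r * b / t := by gcongr
    have h4 : (n : ℝ) ≤ N₁ := by exact_mod_cast h1
    linarith
  have hrest : ((N₁ - N₀ : ℕ) : ℝ) - n ≤ 4 + r * (b - y) / t := by
    have h1 : N₁ - N₀ ≤ n + (3 + (N₁ - N₂)) := by omega
    have h2 : ((N₁ - N₀ : ℕ) : ℝ) ≤ n + (3 + ((N₁ : ℝ) - N₂)) := by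
      rw [← Nat.cast_sub hN21]; exact_mod_cast h1
    have h3 : (N₁ : ℝ) - N₂ ≤ 1 + r * (b - y) / t := by
      have h0 : 0 ≤ r * (b - y) / t :=
        div_nonneg (mul_nonneg hr.le (by linarith)) ht.le
      rcases min_choice N₁ ⌊r * y / t⌋₊ with hc | hc
      · rw [hN₂, hc]; linarith
      · rw [hN₂, hc]
        have h4 := Nat.lt_floor_add_one (r * y / t)
        have h5 := Nat.floor_le q0
        have h6 : r * q / t ≤ r * b / t := by gcongr
        have h7 : r * (b - y) / t = r * b / t - r * y / t := by ring
        linarith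
    linarith
  have hpos : 0 ≤ r * (b - y) / t := div_nonneg (mul_nonneg hr.le (by linarith)) ht.le
  have hnσ : n * σ ≤ r * b / t * σ := by gcongr
  rw [hsum]
  refine (abs_sum_saw_range_le x hnle).trans ?_
  linarith

lemma abs_sum_Ioc_le_sum_pieces (φ : ℕ → ℝ) (m : ℕ) (v : Fin (m + 1) → ℕ) (hv : Monotone v) :
    |∑ j ∈ Finset.Ioc (v 0) (v (Fin.last m)), φ j| ≤
      ∑ i : Fin m, |∑ j ∈ Finset.Ioc (v i.castSucc) (v i.succ), φ j| := by
  induction m with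
  | zero => simp [show Fin.last 0 = 0 from rfl]
  | succ m ih =>
    have h := ih (fun i => v i.castSucc) (fun i j hij => hv (Fin.castSucc_le_castSucc_iff.2 hij))
    rw [Fin.sum_univ_castSucc, ← Finset.sum_Ioc_consecutive φ (hv (Fin.zero_le _))
      (hv (Fin.le_last (Fin.last m).castSucc))]
    refine (abs_add_le _ _).trans (add_le_add h (le_of_eq ?_))
    rw [Fin.succ_last]

/-! ### Estimates as `r → ∞`, uniform for bounded stretches. -/

section asymptotics

variable {h : ℝ → ℝ} {a b M : ℝ}

/-- The piece estimate is applied on each interval of the partition with `y = b - δ r`. The tail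
costs `r * δ r`, and the other terms are kept below `r ^ (1 - 2e)` by the choice of `σ` and `τ`. -/
lemma exists_abs_sum_saw_le (hΓ : IsConvexDecreasingCurve h b M) (ha : 0 < a) (hab : a < b)
    (hreg : IsRegularOn h a b) {δ : ℝ → ℝ} (hδ : ∀ r, 0 < r → δ r ∈ Ioo 0 (b / 2 - a))
    {a₁ a₂ e : ℝ} (hδO : δ =O[atTop] fun r : ℝ => r ^ (-2 * a₁))
    (hhO : (fun r : ℝ => 1 / secondDeriv h a b (b - δ r)) =O[atTop]
      fun r : ℝ => r ^ (1 - 4 * a₂))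
    (he : e ≤ 1 / 6) (he₁ : e ≤ a₁) (he₂ : e ≤ a₂) {C : ℝ} (hC : 1 ≤ C) :
    ∃ K : ℝ, ∀ᶠ r : ℝ in atTop, ∀ t ∈ Icc C⁻¹ C,
      |∑ j ∈ Finset.Ioc ⌊r * a / t⌋₊ ⌊r * b / t⌋₊, saw (r * t * h (j * t / r))| ≤
        K * r ^ (1 - 2 * e) := by
  obtain ⟨c, hc, hmin⟩ := hreg.exists_min_le hab
  obtain ⟨m, p, hp, hp0, hpm, hmono⟩ := hreg.piecewise
  obtain ⟨C₁, hC₁, hB₁⟩ := hδO.exists_pos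
  obtain ⟨C₂, hC₂, hB₂⟩ := hhO.exists_pos
  have hb := hΓ.L_pos
  -- Chosen so that `r / (μ t³) ≤ K₂ r ^ (2 - 4e)`; then `τ = 1 / (κ ρ)` satisfies `τ^6 ≤ μ t³ / r`,
  -- while `1 / τ³ = κ³ r ^ (1 - 2e)`.
  set K₂ := (1 / c + C₂) * C ^ 3 with hK₂
  have hK₂pos : 0 < K₂ := by positivity
  obtain ⟨κ, hκ, hκ6⟩ : ∃ κ : ℝ, 0 < κ ∧ κ ^ 6 = K₂ := by
    refine ⟨K₂ ^ ((1 : ℝ) / 6), by positivity, ?_⟩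
    rw [← Real.rpow_natCast, ← Real.rpow_mul hK₂pos.le]
    norm_num
  set Λ := (M - h a) / a with hΛdef
  have hΛ : 0 ≤ Λ := div_nonneg (sub_nonneg.2 (hΓ.map_mem ⟨ha.le, hab.le⟩).2) ha.le
  refine ⟨m * (121 * (b * C + Λ * C ^ 2 + 2 * κ ^ 3) + 4 + C₁ * C), ?_⟩
  filter_upwards [hB₁.bound, hB₂.bound, eventually_ge_atTop 1] with r h1 h2 hr1 t ht
  have hr : 0 < r := by linarith
  have hC0 : 0 < C := by linarith
  have htpos : 0 < t := (inv_pos.2 hC0).trans_le ht.1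
  have hCt : 1 ≤ C * t := by
    have := mul_le_mul_of_nonneg_left ht.1 hC0.le
    rwa [mul_inv_cancel₀ hC0.ne'] at this
  have htinv : 1 / t ≤ C := by rw [div_le_iff₀ htpos]; exact hCt
  have hδr := hδ r hr
  rw [Real.norm_eq_abs, Real.norm_eq_abs, abs_of_pos hδr.1,
    abs_of_pos (Real.rpow_pos_of_pos hr _)] at h1
  have hsd := hreg.secondDeriv_pos (b - δ r) ⟨by linarith [hδr.2], by linarith [hδr.1]⟩
  rw [Real.norm_eq_abs, Real.norm_eq_abs, abs_of_pos (by positivity),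
    abs_of_pos (Real.rpow_pos_of_pos hr _)] at h2
  set y := b - δ r with hy
  set R := r ^ (1 - 2 * e) with hR
  have hRpos : 0 < R := Real.rpow_pos_of_pos hr _
  have hR1 : 1 ≤ R := Real.one_le_rpow hr1 (by linarith)
  set ρ := r ^ ((1 - 2 * e) / 3) with hρ
  have hρpos : 0 < ρ := Real.rpow_pos_of_pos hr _
  have hρ3 : ρ ^ 3 = R := by
    rw [hρ, hR, ← Real.rpow_natCast, ← Real.rpow_mul hr.le]
    congr 1
    push_cast; ring
  have hR2 : R ^ 2 = r * r ^ (1 - 4 * e) := by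
    rw [hR, ← Real.rpow_natCast, ← Real.rpow_mul hr.le]
    nth_rewrite 2 [← Real.rpow_one r]
    rw [← Real.rpow_add hr]
    congr 1
    push_cast; ring
  -- This makes `r σ` and `1 / σ²` both equal to `r^(2/3)`, which is at most `r ^ (1 - 2e)` because
  -- `e ≤ 1/6`.
  set σ := r ^ (-(1 : ℝ) / 3) with hσ
  have hσpos : 0 < σ := Real.rpow_pos_of_pos hr _
  have hrσ : r * σ ≤ R := by
    nth_rewrite 1 [← Real.rpow_one r]
    rw [hσ, ← Real.rpow_add hr]
    exact Real.rpow_le_rpow_of_exponent_le hr1 (by linarith)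
  have hσ2 : 1 / σ ^ 2 ≤ R := by
    rw [hσ, ← Real.rpow_natCast, ← Real.rpow_mul hr.le, one_div, ← Real.rpow_neg hr.le]
    refine Real.rpow_le_rpow_of_exponent_le hr1 ?_
    push_cast
    linarith
  have hrδ : r * δ r ≤ C₁ * R := by
    calc r * δ r ≤ r * (C₁ * r ^ (-2 * a₁)) := by gcongr
      _ = C₁ * (r * r ^ (-2 * a₁)) := by ring
      _ ≤ C₁ * R := by
        gcongr
        nth_rewrite 1 [← Real.rpow_one r]
        rw [← Real.rpow_add hr]
        exact Real.rpow_le_rpow_of_exponent_le hr1 (by linarith)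
  set μ := min c (secondDeriv h a b y) with hμ
  have hμpos : 0 < μ := lt_min hc hsd
  have hμinv : 1 / μ ≤ (1 / c + C₂) * r ^ (1 - 4 * e) := by
    have g1 : 1 ≤ r ^ (1 - 4 * e) := Real.one_le_rpow hr1 (by linarith)
    have g2 : r ^ (1 - 4 * a₂) ≤ r ^ (1 - 4 * e) :=
      Real.rpow_le_rpow_of_exponent_le hr1 (by linarith)
    have g3 : 1 / μ ≤ 1 / c + 1 / secondDeriv h a b y := by
      have q1 : 0 < 1 / c := by positivity
      have q2 : 0 < 1 / secondDeriv h a b y := by positivity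
      rcases min_choice c (secondDeriv h a b y) with hm | hm <;> rw [hμ, hm] <;> linarith
    have g4 : 1 / c ≤ 1 / c * r ^ (1 - 4 * e) := le_mul_of_one_le_right (by positivity) g1
    have g5 : C₂ * r ^ (1 - 4 * a₂) ≤ C₂ * r ^ (1 - 4 * e) := by gcongr
    rw [add_mul]
    linarith
  set τ := 1 / (κ * ρ) with hτ
  have hτpos : 0 < τ := by positivity
  have hτ6 : τ ^ 6 ≤ μ * t ^ 3 / r := by
    have e1 : τ ^ 6 = 1 / (K₂ * (r * r ^ (1 - 4 * e))) := by
      rw [hτ, div_pow, one_pow, mul_pow, hκ6, show ρ ^ 6 = (ρ ^ 3) ^ 2 by ring, hρ3, hR2]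
    rw [e1, div_le_div_iff₀ (by positivity) hr, one_mul]
    rw [div_le_iff₀ hμpos] at hμinv
    have e2 : (1 : ℝ) ≤ (C * t) ^ 3 := one_le_pow₀ hCt
    calc r = r * 1 * 1 := by ring
      _ ≤ r * ((1 / c + C₂) * r ^ (1 - 4 * e) * μ) * (C * t) ^ 3 := by gcongr
      _ = μ * t ^ 3 * (K₂ * (r * r ^ (1 - 4 * e))) := by rw [hK₂]; ring
  have hτ3 : 2 / τ ^ 3 = 2 * κ ^ 3 * R := by
    rw [← hρ3, hτ]; field_simp
  have ht2 : t ^ 2 ≤ C ^ 2 := by have := ht.2; gcongr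
  have mem : ∀ i, p i ∈ Icc a b := fun i => by
    rw [← hp0, ← hpm]; exact ⟨hp.monotone (Fin.zero_le _), hp.monotone (Fin.le_last _)⟩
  have piece : ∀ i : Fin m,
      |∑ j ∈ Finset.Ioc ⌊r * p i.castSucc / t⌋₊ ⌊r * p i.succ / t⌋₊,
        saw (r * t * h (j * t / r))| ≤
        (121 * (b * C + Λ * C ^ 2 + 2 * κ ^ 3) + 4 + C₁ * C) * R := by
    intro i
    have := abs_sum_saw_piece_le hΓ ha (mem i.castSucc).1
      (hp (Fin.castSucc_lt_succ (i := i))).le (mem i.succ).2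
      (y := y) (by linarith [hδr.2]) (by linarith [hδr.1])
      (fun x hx => hreg.hasDerivAt hx) (fun x hx => hreg.hasDerivAt_derivWithin hx) (hmono i)
      (fun x hx hxy => hmin x y hx hxy.le (by linarith [hδr.1])) hr htpos hσpos hτpos hτ6
    refine this.trans ?_
    rw [← hΛdef, hτ3]
    have q1 : r * b / t * σ ≤ b * C * R := by
      calc r * b / t * σ = b * (1 / t) * (r * σ) := by ring
        _ ≤ b * C * R := by gcongr
    have q2 : Λ * t ^ 2 / σ ^ 2 ≤ Λ * C ^ 2 * R := by
      calc Λ * t ^ 2 / σ ^ 2 = Λ * t ^ 2 * (1 / σ ^ 2) := by ring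
        _ ≤ _ := by gcongr
    have q3 : r * (b - y) / t ≤ C₁ * C * R := by
      calc r * (b - y) / t = r * δ r * (1 / t) := by rw [hy]; ring
        _ ≤ C₁ * R * C := by have := hδr.1; gcongr
        _ = _ := by ring
    linarith
  have hv : Monotone fun i => ⌊r * p i / t⌋₊ := by
    intro i j hij
    have := hp.monotone hij
    exact Nat.floor_le_floor (by gcongr)
  have hfin := abs_sum_Ioc_le_sum_pieces (fun j => saw (r * t * h (j * t / r))) m _ hv
  simp only [hp0, hpm] at hfin
  refine hfin.trans ((Finset.sum_le_sum fun i _ => piece i).trans (le_of_eq ?_))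
  rw [Finset.sum_const, Finset.card_univ, Fintype.card_fin, nsmul_eq_mul]
  ring

lemma exists_abs_sum_floor_le (hΓ : IsConvexDecreasingCurve h b M) (ha : 0 < a) (hab : a < b)
    (hreg : IsRegularOn h a b) {δ : ℝ → ℝ} (hδ : ∀ r, 0 < r → δ r ∈ Ioo 0 (b / 2 - a))
    {a₁ a₂ e : ℝ} (hδO : δ =O[atTop] fun r : ℝ => r ^ (-2 * a₁))
    (hhO : (fun r : ℝ => 1 / secondDeriv h a b (b - δ r)) =O[atTop]
      fun r : ℝ => r ^ (1 - 4 * a₂))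
    (he : e ≤ 1 / 6) (he₁ : e ≤ a₁) (he₂ : e ≤ a₂) {C : ℝ} (hC : 1 ≤ C) :
    ∃ K : ℝ, ∀ᶠ r : ℝ in atTop, ∀ t ∈ Icc C⁻¹ C,
      |((∑ j ∈ Finset.Ioc ⌊r * a / t⌋₊ ⌊r * b / t⌋₊, ⌊r * t * h (j * t / r)⌋₊ : ℕ) : ℝ) -
        (r ^ 2 * (∫ x in a..b, h x) + saw (r * a / t) * (r * t * h a)
          - (r * b / t - r * a / t) / 2)| ≤ K * r ^ (1 - 2 * e) := by
  obtain ⟨K, hK⟩ := exists_abs_sum_saw_le hΓ ha hab hreg hδ hδO hhO he he₁ he₂ hC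
  set Λ := (M - h a) / a with hΛdef
  have hΛ : 0 ≤ Λ := div_nonneg (sub_nonneg.2 (hΓ.map_mem ⟨ha.le, hab.le⟩).2) ha.le
  refine ⟨K + (4 * (Λ * C ^ 2) + 1 / 2), ?_⟩
  filter_upwards [hK, eventually_ge_atTop 1] with r h1 hr1 t ht
  have hr : 0 < r := by linarith
  have hC0 : 0 < C := by linarith
  have htpos : 0 < t := (inv_pos.2 hC0).trans_le ht.1
  have h1 := h1 t ht
  have hR1 : 1 ≤ r ^ (1 - 2 * e) := Real.one_le_rpow hr1 (by linarith)
  have ea : r * a / t * t / r = a := by field_simp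
  have eb : r * b / t * t / r = b := by field_simp
  have hAB : r * a / t ≤ r * b / t := by gcongr
  have hmaps : ∀ x ∈ Icc (r * a / t) (r * b / t), x * t / r ∈ Icc a b := by
    intro x hx
    rw [← ea, ← eb]
    have h1 := hx.1
    have h2 := hx.2
    constructor <;> gcongr
  have hsub : Icc a b ⊆ Icc 0 b := Icc_subset_Icc ha.le le_rfl
  -- The scaled function has Lipschitz constant `Λ t²`, which is independent of `r`, so the
  -- Euler–Maclaurin error is bounded.
  have key := abs_sum_floor_sub_le (F := fun x => r * t * h (x * t / r)) (a := r * a / t)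
    (b := r * b / t) (Λ := Λ * t ^ 2) (by positivity) hAB (by positivity) ?_ ?_ ?_ ?_ ?_
  · have hint : ∫ x in (r * a / t)..(r * b / t), r * t * h (x * t / r) =
        r ^ 2 * ∫ x in a..b, h x := by
      rw [intervalIntegral.integral_const_mul]
      have : ∀ x : ℝ, x * t / r = x * (t / r) := fun x => by ring
      simp_rw [this]
      rw [intervalIntegral.integral_comp_mul_right h (by positivity), ← mul_div_assoc, ea,
        ← mul_div_assoc, eb, smul_eq_mul]
      field_simp
    simp only [ea] at key
    rw [hint] at key
    refine key.trans ?_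
    have ht2 : t ^ 2 ≤ C ^ 2 := by have := ht.2; gcongr
    have : 4 * (Λ * t ^ 2) + 1 / 2 ≤ (4 * (Λ * C ^ 2) + 1 / 2) * r ^ (1 - 2 * e) := by
      calc 4 * (Λ * t ^ 2) + 1 / 2 ≤ (4 * (Λ * C ^ 2) + 1 / 2) * 1 := by
            rw [mul_one]; gcongr
        _ ≤ _ := by gcongr
    rw [add_mul]
    linarith
  · refine ⟨convex_Icc _ _, fun x hx y hy w z hw hz hwz => ?_⟩
    have := hΓ.convex.2 (hsub (hmaps x hx)) (hsub (hmaps y hy)) hw hz hwz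
    simp only [smul_eq_mul] at this ⊢
    rw [show (w * x + z * y) * t / r = w * (x * t / r) + z * (y * t / r) by ring]
    calc _ ≤ r * t * (w * h (x * t / r) + z * h (y * t / r)) := by gcongr
      _ = _ := by ring
  · exact continuousOn_const.mul (hΓ.continuous.comp (by fun_prop)
      fun x hx => hsub (hmaps x hx))
  · intro x hx y hy hxy
    have := hΓ.strictAnti.antitoneOn (hsub (hmaps x hx)) (hsub (hmaps y hy))
      (show x * t / r ≤ y * t / r by gcongr)
    simp only
    gcongr
  · intro x hx y hy hxy
    have := hΓ.lipschitz ha (hmaps x hx).1 (show x * t / r ≤ y * t / r by gcongr) (hmaps y hy).2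
    calc _ = r * t * (h (x * t / r) - Λ * (y * t / r - x * t / r)) := by
          field_simp
      _ ≤ _ := by gcongr
  · simp only [eb, hΓ.map_L, mul_zero]

end asymptotics

/-! ### The two-term formula and the optimal stretch. -/

lemma IsConvexDecreasingCurve.curveArea_inverse {f : ℝ → ℝ} {L M : ℝ}
    (h : IsConvexDecreasingCurve f L M) : curveArea (curveInverse f L) M = curveArea f L := by
  have := h.integral_sub_eq_integral_inverse (α := L) (right_mem_Icc.2 h.L_pos.le)
  rw [h.map_L] at this
  rw [h.curveArea_eq, h.inverse.curveArea_eq, ← this]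
  simp

/-- The two-term asymptotic formula for the lattice count, uniformly for bounded stretching. -/
lemma exists_abs_latticeCount_sub_le {f : ℝ → ℝ} {L M α : ℝ}
    (hΓ : IsConvexDecreasingCurve f L M) (hα_pos : 0 < α) (hα : α < L / 2)
    (hβ_pos : 0 < f α) (hβ : f α < M / 2)
    (hf : IsRegularOn f α L) (hg : IsRegularOn (curveInverse f L) (f α) M)
    {δ ε : ℝ → ℝ} (hδ : ∀ r, 0 < r → δ r ∈ Ioo 0 (L / 2 - α))
    (hε : ∀ r, 0 < r → ε r ∈ Ioo 0 (M / 2 - f α))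
    {a₁ a₂ b₁ b₂ e : ℝ} (hδO : δ =O[atTop] fun r : ℝ => r ^ (-2 * a₁))
    (hfO : (fun r : ℝ => 1 / secondDeriv f α L (L - δ r)) =O[atTop]
      fun r : ℝ => r ^ (1 - 4 * a₂))
    (hεO : ε =O[atTop] fun r : ℝ => r ^ (-2 * b₁))
    (hgO : (fun r : ℝ => 1 / secondDeriv (curveInverse f L) (f α) M (M - ε r)) =O[atTop]
      fun r : ℝ => r ^ (1 - 4 * b₂))
    (he : e ≤ 1 / 6) (ha₁ : e ≤ a₁) (ha₂ : e ≤ a₂) (hb₁ : e ≤ b₁) (hb₂ : e ≤ b₂)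
    {C : ℝ} (hC : 1 ≤ C) :
    ∃ K : ℝ, ∀ᶠ r : ℝ in atTop, ∀ s ∈ Icc C⁻¹ C,
      |(latticeCount f L r s : ℝ) - (r ^ 2 * curveArea f L - r * (L / s + M * s) / 2)| ≤
        K * r ^ (1 - 2 * e) := by
  have hL := hΓ.L_pos
  have hM := hΓ.M_pos
  have hαmem : α ∈ Icc 0 L := ⟨hα_pos.le, by linarith⟩
  obtain ⟨K₁, hK₁⟩ := exists_abs_sum_floor_le hΓ hα_pos (by linarith) hf hδ hδO hfO he ha₁ ha₂ hC
  obtain ⟨K₂, hK₂⟩ := exists_abs_sum_floor_le hΓ.inverse hβ_pos (by linarith) hg hε hεO hgO he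
    hb₁ hb₂ hC
  refine ⟨K₁ + K₂ + 1, ?_⟩
  filter_upwards [hK₁, hK₂, eventually_ge_atTop 1] with r h1 h2 hr1 s hs
  have hr : 0 < r := by linarith
  have hC0 : 0 < C := by linarith
  have hspos : 0 < s := (inv_pos.2 hC0).trans_le hs.1
  have hs' : s⁻¹ ∈ Icc C⁻¹ C :=
    ⟨inv_anti₀ hspos hs.2, by rw [inv_le_comm₀ hspos hC0]; exact hs.1⟩
  have h1 := abs_le.1 (h1 s hs)
  have h2 := abs_le.1 (h2 s⁻¹ hs')
  have hR1 : 1 ≤ r ^ (1 - 2 * e) := Real.one_le_rpow hr1 (by linarith)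
  rw [hΓ.latticeCount_split hr hspos hαmem, hΓ.curveArea_split hαmem, Nat.cast_add, Nat.cast_add,
    Nat.cast_mul]
  rw [hΓ.inverse_apply hαmem] at h2
  set X := r * α / s with hX
  set Y := r * f α / s⁻¹ with hY
  have hX0 : 0 ≤ X := by positivity
  have hY0 : 0 ≤ Y := by positivity
  have fX : (⌊X⌋₊ : ℝ) = X - saw X - 1 / 2 := by
    rw [saw, Int.fract, natCast_floor_eq_intCast_floor hX0]; ring
  have fY : (⌊Y⌋₊ : ℝ) = Y - saw Y - 1 / 2 := by
    rw [saw, Int.fract, natCast_floor_eq_intCast_floor hY0]; ring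
  have eY : r * s * f α = Y := by rw [hY, div_inv_eq_mul]; ring
  have eX : r * s⁻¹ * α = X := by rw [hX]; ring
  have eXY : r ^ 2 * (α * f α) = X * Y := by rw [hX, hY]; field_simp
  have eLM : r * (L / s + M * s) / 2 = (r * L / s + r * M / s⁻¹) / 2 := by
    rw [div_inv_eq_mul]; ring
  have sX := abs_le.1 (abs_saw_le X)
  have sY := abs_le.1 (abs_saw_le Y)
  -- Expanding `⌊X⌋₊ * ⌊Y⌋₊` cancels the boundary terms `saw X * Y` and `saw Y * X` of the two floor
  -- sums, as well as `X / 2` and `Y / 2`; only this bounded product survives.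
  have p0 : 0 ≤ (saw X + 1 / 2) * (saw Y + 1 / 2) := mul_nonneg (by linarith) (by linarith)
  have p1 : (saw X + 1 / 2) * (saw Y + 1 / 2) ≤ 1 :=
    mul_le_one₀ (by linarith) (by linarith) (by linarith)
  rw [eY] at h1
  rw [eX] at h2
  rw [fX, fY, eLM, mul_add, mul_add, eXY, add_mul, add_mul, one_mul, abs_le]
  constructor <;> linarith [h1.1, h1.2, h2.1, h2.2]

/-- A stretch `s` loses at least `c r² min (s / r) L` against the area, whereas `s = 1` loses at
most `B r`. Once `r > B / (c L)` the minimum cannot be `L`, and `s ≤ B / c` follows. -/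
lemma exists_stretch_bound {f : ℝ → ℝ} {L M : ℝ} (h : IsConvexDecreasingCurve f L M)
    {B : ℝ}
    (hlow : ∀ᶠ r : ℝ in atTop, r ^ 2 * curveArea f L - B * r ≤ latticeCount f L r 1) :
    ∃ D : ℝ, ∀ᶠ r : ℝ in atTop, ∀ s > 0, latticeCount f L r 1 ≤ latticeCount f L r s → s ≤ D := by
  have hL := h.L_pos
  have hc : 0 < f (L / 2) / 4 := by
    have := h.strictAnti (a := L / 2) (b := L) ⟨by linarith, by linarith⟩ ⟨hL.le, le_rfl⟩
      (by linarith)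
    rw [h.map_L] at this
    positivity
  set c := f (L / 2) / 4
  refine ⟨B / c, ?_⟩
  filter_upwards [hlow, eventually_gt_atTop 0, eventually_gt_atTop (B / (c * L))]
    with r h1 hr hrB s hs hle
  have h2 := h.latticeCount_le hr hs
  change _ ≤ r ^ 2 * (curveArea f L - c * min (s / r) L) at h2
  have h3 : (latticeCount f L r 1 : ℝ) ≤ latticeCount f L r s := by exact_mod_cast hle
  have h4 : r * (c * (r * min (s / r) L)) ≤ r * B := by nlinarith
  have h5 := le_of_mul_le_mul_left h4 hr
  rw [div_lt_iff₀ (by positivity)] at hrB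
  rw [le_div_iff₀ hc]
  rcases min_choice (s / r) L with hm | hm
  · rw [hm, mul_div_cancel₀ _ hr.ne'] at h5
    linarith
  · rw [hm] at h5
    nlinarith

theorem mainTheorem1
    (f : ℝ → ℝ) (L M α β : ℝ)
    (hΓ : IsConvexDecreasingCurve f L M)
    (hα_pos : 0 < α) (hβ_pos : 0 < β) (hαβ : f α = β)
    (hα : α < L / 2) (hβ : β < M / 2)
    (hf : IsRegularOn f α L)
    (hg : IsRegularOn (curveInverse f L) β M)
    (δ ε : ℝ → ℝ)
    (hδ : ∀ r, 0 < r → δ r ∈ Ioo 0 (L / 2 - α))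
    (hε : ∀ r, 0 < r → ε r ∈ Ioo 0 (M / 2 - β))
    (a₁ a₂ b₁ b₂ : ℝ) (ha₁ : 0 < a₁) (ha₂ : 0 < a₂) (hb₁ : 0 < b₁) (hb₂ : 0 < b₂)
    (hδO : δ =O[atTop] fun r : ℝ => r ^ (-2 * a₁))
    (hfO : (fun r : ℝ => 1 / secondDeriv f α L (L - δ r)) =O[atTop]
      fun r : ℝ => r ^ (1 - 4 * a₂))
    (hεO : ε =O[atTop] fun r : ℝ => r ^ (-2 * b₁))
    (hgO : (fun r : ℝ => 1 / secondDeriv (curveInverse f L) β M (M - ε r)) =O[atTop]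
      fun r : ℝ => r ^ (1 - 4 * b₂))
    (hLM : L = M)
    (e : ℝ) (he : e = min (1 / 6) (min (min a₁ a₂) (min b₁ b₂))) :
    -- for every `r > 0` the maximum over `s > 0` is attained
    (∀ r, 0 < r → (optimalStretch f L r).Nonempty ∧
      IsGreatest (latticeCount f L r '' Ioi 0) (maxLatticeCount f L r)) ∧
    -- the optimal stretch factors approach `1`
    (∀ η : ℝ, 0 < η → ∀ᶠ r : ℝ in atTop, ∀ s ∈ optimalStretch f L r, |s - 1| < η) ∧
    -- `S(r) ⊆ [1 - O(r ^ (-e)), 1 + O(r ^ (-e))]`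
    (∃ C : ℝ, ∀ᶠ r : ℝ in atTop,
      optimalStretch f L r ⊆ Icc (1 - C * r ^ (-e)) (1 + C * r ^ (-e))) ∧
    -- asymptotic formula for the maximal lattice count
    ((fun r : ℝ => (maxLatticeCount f L r : ℝ) - (r ^ 2 * curveArea f L - r * L)) =O[atTop]
      fun r : ℝ => r ^ (1 - 2 * e)) := by
  subst hαβ
  have he1 : e ≤ 1 / 6 := by rw [he]; exact min_le_left _ _
  have he2 : e ≤ min (min a₁ a₂) (min b₁ b₂) := by rw [he]; exact min_le_right _ _
  have hea : e ≤ min a₁ a₂ := he2.trans (min_le_left _ _)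
  have heb : e ≤ min b₁ b₂ := he2.trans (min_le_right _ _)
  have he_pos : 0 < e := by rw [he]; positivity
  have asym := fun {C : ℝ} (hC : 1 ≤ C) => exists_abs_latticeCount_sub_le hΓ hα_pos hα hβ_pos hβ hf
    hg hδ hε hδO hfO hεO hgO he1 (hea.trans (min_le_left _ _)) (hea.trans (min_le_right _ _))
    (heb.trans (min_le_left _ _)) (heb.trans (min_le_right _ _)) hC
  subst hLM
  have hL := hΓ.L_pos
  have attained := fun (r : ℝ) (hr : 0 < r) => hΓ.isGreatest_latticeCount hr
  -- the optimal stretch factors stay in a compact set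
  obtain ⟨C, hC, hbound⟩ : ∃ C : ℝ, 1 ≤ C ∧ ∀ᶠ r : ℝ in atTop,
      ∀ s ∈ optimalStretch f L r, s ∈ Icc C⁻¹ C := by
    -- With `C = 1` the formula concerns `s = 1` alone; it is needed before any compact range for
    -- the maximizers is known.
    obtain ⟨K, hK⟩ := asym le_rfl
    have hlow : ∀ᶠ r : ℝ in atTop,
        r ^ 2 * curveArea f L - (L + |K|) * r ≤ latticeCount f L r 1 := by
      filter_upwards [hK, eventually_ge_atTop 1] with r h1 hr1
      have h2 := (abs_le.1 (h1 1 (by simp))).1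
      have h3 : r ^ (1 - 2 * e) ≤ r := by
        conv_rhs => rw [← Real.rpow_one r]
        exact Real.rpow_le_rpow_of_exponent_le hr1 (by linarith)
      have h4 : K * r ^ (1 - 2 * e) ≤ |K| * r :=
        mul_le_mul (le_abs_self K) h3 (by positivity) (abs_nonneg K)
      rw [div_one, mul_one] at h2
      linarith
    obtain ⟨D₁, hD₁⟩ := exists_stretch_bound hΓ hlow
    -- The inverse curve has the same area and the same count at `1`, so its stretch bound applied
    -- to `s⁻¹` keeps `s` away from zero.
    obtain ⟨D₂, hD₂⟩ := exists_stretch_bound hΓ.inverse (by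
      filter_upwards [hlow, eventually_gt_atTop 0] with r h1 hr
      have := hΓ.latticeCount_inverse hr one_pos
      rw [inv_one] at this
      rwa [hΓ.curveArea_inverse, this])
    refine ⟨max 1 (max D₁ D₂), le_max_left _ _, ?_⟩
    filter_upwards [hD₁, hD₂, eventually_gt_atTop 0] with r h1 h2 hr s hs
    have hs0 : 0 < s := hs.1
    have hinv := hΓ.latticeCount_inverse hr one_pos
    rw [inv_one] at hinv
    constructor
    · rw [inv_le_comm₀ (by positivity) hs0]
      refine (h2 s⁻¹ (inv_pos.2 hs0) ?_).trans ((le_max_right _ _).trans (le_max_right _ _))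
      rw [hinv, hΓ.latticeCount_inverse hr hs0]
      exact hs.2 1 one_pos
    · exact (h1 s hs0 (hs.2 1 one_pos)).trans ((le_max_left _ _).trans (le_max_right _ _))
  obtain ⟨K, hK⟩ := asym hC
  have hone : (1 : ℝ) ∈ Icc C⁻¹ C := ⟨inv_le_one_of_one_le₀ hC, hC⟩
  have hrate : ∀ᶠ r : ℝ in atTop, ∀ s ∈ optimalStretch f L r,
      |s - 1| ≤ √(4 * |K| * C / L) * r ^ (-e) := by
    filter_upwards [hbound, hK, eventually_gt_atTop 0] with r h1 h2 hr s hs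
    have hmem := h1 s hs
    have hs0 : 0 < s := hs.1
    have b1 := (abs_le.1 (h2 1 hone)).1
    have b2 := (abs_le.1 (h2 s hmem)).2
    have b3 : (latticeCount f L r 1 : ℝ) ≤ latticeCount f L r s := by
      exact_mod_cast hs.2 1 one_pos
    have hsplit : r ^ (1 - 2 * e) = r * (r ^ (-e)) ^ 2 := by
      rw [← Real.rpow_natCast, ← Real.rpow_mul hr.le]
      nth_rewrite 2 [← Real.rpow_one r]
      rw [← Real.rpow_add hr]
      congr 1
      push_cast; ring
    rw [hsplit] at b1 b2
    set w := r ^ (-e)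
    have hw : 0 < w := Real.rpow_pos_of_pos hr _
    -- The equality of the intercepts makes the second-order term a square centred at `1`.
    have e1 : L / s + L * s - 2 * L = L * (s - 1) ^ 2 / s := by field_simp; ring
    have h3 : r * (L * (s - 1) ^ 2 / s) ≤ r * (4 * |K| * w ^ 2) := by
      rw [← e1]
      have : K * (r * w ^ 2) ≤ |K| * (r * w ^ 2) := by gcongr; exact le_abs_self K
      rw [div_one, mul_one] at b1
      linarith
    have h4 := le_of_mul_le_mul_left h3 hr
    rw [div_le_iff₀ hs0] at h4
    have h5 : (s - 1) ^ 2 ≤ 4 * |K| * C / L * w ^ 2 := by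
      rw [div_mul_eq_mul_div, le_div_iff₀ hL]
      have : 4 * |K| * w ^ 2 * s ≤ 4 * |K| * w ^ 2 * C := by
        have := hmem.2; gcongr
      linarith
    have h6 := Real.sqrt_le_sqrt h5
    rwa [Real.sqrt_sq_eq_abs, Real.sqrt_mul (by positivity), Real.sqrt_sq hw.le] at h6
  refine ⟨attained, fun η hη => ?_, ⟨√(4 * |K| * C / L), ?_⟩, ?_⟩
  · have hlim : Tendsto (fun r : ℝ => √(4 * |K| * C / L) * r ^ (-e)) atTop (nhds 0) := by
      simpa using (tendsto_rpow_neg_atTop he_pos).const_mul (√(4 * |K| * C / L))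
    filter_upwards [hrate, hlim.eventually_lt_const hη] with r h1 h2 s hs
    exact (h1 s hs).trans_lt h2
  · filter_upwards [hrate] with r h1 s hs
    have := abs_le.1 (h1 s hs)
    exact ⟨by linarith, by linarith⟩
  · refine IsBigO.of_bound |K| ?_
    filter_upwards [hbound, hK, eventually_gt_atTop 0] with r h1 h2 hr
    obtain ⟨s, hs, hmax⟩ := (attained r hr).2.1
    have hs0 : 0 < s := hs
    have hsopt : s ∈ optimalStretch f L r :=
      ⟨hs0, fun t ht => hmax ▸ (attained r hr).2.2 ⟨t, ht, rfl⟩⟩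
    have b1 := (abs_le.1 (h2 1 hone)).1
    have b2 := (abs_le.1 (h2 s (h1 s hsopt))).2
    have b3 : (latticeCount f L r 1 : ℝ) ≤ latticeCount f L r s := by
      exact_mod_cast hsopt.2 1 one_pos
    -- Nonnegativity of this square turns the formula at the maximizer into the upper bound; the
    -- formula at `1` gives the lower bound.
    have e1 : L / s + L * s - 2 * L = L * (s - 1) ^ 2 / s := by field_simp; ring
    have e2 : 0 ≤ r * (L * (s - 1) ^ 2 / s) := by positivity
    rw [← e1] at e2
    rw [div_one, mul_one] at b1
    have h3 : K * r ^ (1 - 2 * e) ≤ |K| * r ^ (1 - 2 * e) := by gcongr; exact le_abs_self K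
    rw [← hmax, Real.norm_eq_abs, Real.norm_eq_abs, abs_of_pos (Real.rpow_pos_of_pos hr _), abs_le]
    constructor <;> linarith
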